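/- Let $N\ge 4$ be an integer. For a prime $\ell\ge 3$, write $a\equiv b$ if $a,b\in\mathbb{F}_\ell$ satisfy $a=u^2b$ for some $u\in\mathbb{F}_\ell^\times$. A non-degenerate quadratic $\mathbb{F}_\ell$-space $(V,\Psi)$ is a finite-dimensional $\mathbb{F}_\ell$-vector space $V$ with a non-degenerate symmetric bilinear form $\Psi$; $\mathrm{O}(V)$ is its isometry group, $\Omega(V)$ is the derived (commutator) subgroup of $\mathrm{O}(V)$, and $\det\Psi$ is the Gram determinant in a basis, well defined up to $\equiv$. If $\dim V=N$ is even, $(V,\Psi)$ is called split if $(-1)^{N/2}\det\Psi\equiv 1$. (1) Let $\ell\geq 3$ be a prime and let $f\in\mathbb{F}_\ell[T]$ be a monic polynomial of degree $N$ such that $T^Nf(1/T)=\varepsilon f(T)$ for some $\varepsilon\in\{1,-1\}$. Then there are a non-degenerate $N$-dimensional quadratic $\mathbb{F}_\ell$-space $(V,\Psi)$ and an isometry $\gamma$ of it with $\det(T-\gamma)=f(T)$. Moreover, if $N$ is even, $f(1)\ne0$ and $f(-1)\neq 0$, then every non-degenerate $N$-dimensional quadratic $\mathbb{F}_\ell$-space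 $(V,\Psi)$ having an isometry $\gamma$ with $\det(T-\gamma)=f(T)$ satisfies $\det\Psi\equiv f(-1)f(1)$. (2) There is a constant $c=c(N)>0$, depending only on $N$, such that the following holds for every prime $\ell\ge N+4$. Let $(V,\Psi)$ be a non-degenerate $N$-dimensional quadratic $\mathbb{F}_\ell$-space, assumed to be split if $N$ is even, let $\alpha\in\mathrm{O}(V)$, and put $$\Theta=\{M\in\alpha\,\Omega(V):\ \det(1-TM)\text{ is separable and split over }\mathbb{F}_\ell\}.$$ Then $$\frac{\#\Theta}{\#\Omega(V)}\ \ge\ c .$$ -/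

import Mathlib

open Polynomial

noncomputable section

namespace OrthogonalCount

/-- `a ≡ b` modulo the group of non-zero squares of `K`. -/
def SquareClassEq {K : Type*} [Field K] (a b : K) : Prop :=
  ∃ u : K, u ≠ 0 ∧ a = u ^ 2 * b

/-- `T ^ N * f (1 / T) = ε * f T` for some sign `ε = ± 1`
(`f.reflect N` is the polynomial `T ^ N * f (1 / T)` when `f` has degree at most `N`). -/
def SatisfiesFunctionalEquation {K : Type*} [Field K] (N : ℕ) (f : K[X]) : Prop :=
  ∃ ε : K, (ε = 1 ∨ ε = -1) ∧ f.reflect N = C ε * f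

section Space

variable {K : Type*} [Field K] {V : Type*} [AddCommGroup V] [Module K V]

/-- The orthogonal group of the bilinear space `(V, Ψ)`. -/
def orthogonalGroup (Ψ : LinearMap.BilinForm K V) : Subgroup (V ≃ₗ[K] V) where
  carrier := {g | ∀ x y, Ψ (g x) (g y) = Ψ x y}
  one_mem' := fun _ _ => rfl
  mul_mem' := fun {g h} hg hh x y => (hg (h x) (h y)).trans (hh x y)
  inv_mem' := fun {g} hg x y => by
    have h := hg (g⁻¹ x) (g⁻¹ y)
    have e : ∀ z, g (g⁻¹ z) = z := fun z => LinearEquiv.apply_symm_apply g z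
    rw [e, e] at h
    exact h.symm

/-- The derived group `Ω` of the orthogonal group. -/
def derivedOrthogonalGroup (Ψ : LinearMap.BilinForm K V) : Subgroup (orthogonalGroup Ψ) :=
  commutator (orthogonalGroup Ψ)

/-- The underlying endomorphism of an isometry. -/
def toEnd {Ψ : LinearMap.BilinForm K V} (M : orthogonalGroup Ψ) : V →ₗ[K] V :=
  ((M : V ≃ₗ[K] V) : V →ₗ[K] V)

/-- `det Ψ ≡ d` modulo squares: the Gram determinant of `Ψ` in some basis has class `d`.
The choice of the basis does not matter, see `hasDet_iff_forall`. -/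
def HasDet (Ψ : LinearMap.BilinForm K V) (d : K) : Prop :=
  ∃ b : Module.Basis (Fin (Module.finrank K V)) K V,
    SquareClassEq (LinearMap.BilinForm.toMatrix b Ψ).det d

theorem gram_det_squareClassEq {n : ℕ} (b c : Module.Basis (Fin n) K V)
    (Ψ : LinearMap.BilinForm K V) :
    SquareClassEq (LinearMap.BilinForm.toMatrix c Ψ).det
      (LinearMap.BilinForm.toMatrix b Ψ).det := by
  refine ⟨(b.toMatrix c).det, ?_, ?_⟩
  · intro h
    have h1 := congrArg Matrix.det (b.toMatrix_mul_toMatrix_flip c)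
    rw [Matrix.det_mul, h, zero_mul, Matrix.det_one] at h1
    exact zero_ne_one h1
  · rw [← LinearMap.BilinForm.toMatrix_mul_basis_toMatrix b c Ψ, Matrix.det_mul, Matrix.det_mul,
      Matrix.det_transpose]
    ring

theorem hasDet_iff_forall [FiniteDimensional K V] (Ψ : LinearMap.BilinForm K V) (d : K) :
    HasDet Ψ d ↔ ∀ b : Module.Basis (Fin (Module.finrank K V)) K V,
      SquareClassEq (LinearMap.BilinForm.toMatrix b Ψ).det d := by
  constructor
  · rintro ⟨b, u, hu, h⟩ c
    obtain ⟨v, hv, h'⟩ := gram_det_squareClassEq b c Ψ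
    exact ⟨v * u, mul_ne_zero hv hu, by rw [h', h]; ring⟩
  · intro h
    exact ⟨Module.finBasis K V, h _⟩

/-- An even-dimensional space `(V, Ψ)` is split if `(-1) ^ (dim V / 2) * det Ψ ≡ 1`, that is,
`det Ψ ≡ (-1) ^ (dim V / 2)`, modulo squares. -/
def IsSplit (Ψ : LinearMap.BilinForm K V) : Prop :=
  ∃ b : Module.Basis (Fin (Module.finrank K V)) K V,
    SquareClassEq
      ((-1) ^ (Module.finrank K V / 2) * (LinearMap.BilinForm.toMatrix b Ψ).det) 1

/-- The polynomial `det (1 - T M)`. -/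
def detOneSub [FiniteDimensional K V] (M : V →ₗ[K] V) : K[X] :=
  ((1 : Matrix _ _ K[X]) -
    (X : K[X]) • (LinearMap.toMatrix (Module.finBasis K V) (Module.finBasis K V) M).map C).det

/-- The set `Θ` of all `M ∈ α Ω` such that `det (1 - T M)` is separable and split over `K`. -/
def Theta [FiniteDimensional K V] (Ψ : LinearMap.BilinForm K V) (α : orthogonalGroup Ψ) :
    Set (orthogonalGroup Ψ) :=
  {M | (∃ ω ∈ derivedOrthogonalGroup Ψ, M = α * ω) ∧
    (detOneSub (toEnd M)).Separable ∧ (detOneSub (toEnd M)).Splits}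

end Space

end OrthogonalCount

end

open Polynomial

noncomputable section

universe u v

namespace OrthogonalCount

/-! Part (1), existence. Factors `X - 1` and `X + 1` are realised on lines and split off
orthogonally. If `f` vanishes at neither `1` nor `-1`, the functional equation forces even degree
`2m` and `f(T) = T^m P(T + 1/T)` with `P` monic. `P` is the characteristic polynomial of a matrix
`S` self-adjoint for a non-degenerate symmetric `G` (`exists_symm_matrix_of_monic`). Adjoining `γ`
with `γ + γ⁻¹ = S` doubles the space, and `isIsometryCharpoly_of_symm` gives the invariant form; it
is non-degenerate because `P(2)` and `P(-2)` are nonzero.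

Part (1), determinant. For a Gram matrix `G` with isometry `A`, the skew matrix `AᵀG - GA` times `A`
is `G(1 - A)(1 + A)`. Skew determinants are squares and `det A = 1`, so `det G` has the class of
`f(1) f(-1)`.

Part (2). Over a finite field `V` is a sum of `k` hyperbolic planes and a complement of dimension at
most 2. The quotient `O/Ω` is generated by reflection classes `ρ δ^a`, where `ρ` and `δ` are
involutions and `a` is a discrete logarithm of the norm (`exists_reflection_classes`). A torus
element with eigenvalues `g^(a i)`, `g^(-a i)` on the planes has class `δ^(∑ a i)`, so a parity
condition, together with one reflection in the complement when `α` has class `ρ δ^p`, puts it in the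
coset of `α`. A positive proportion of the torus can be kept with all eigenvalues distinct.
Conjugates of these elements lie in `Θ`, and a fibre of `(h, D) ↦ h D h⁻¹` embeds in the isometries
permuting the eigenlines, of which there are at most `N^N ℓ^k 2^r`. Hence `#O · B^k ≤ N^N ℓ^k 2^r ·
#Θ` with `B` of the order of `ℓ`, and `#Ω ≤ #O` finishes (`card_mul_card_le_card_Theta_mul`). -/

/-! ### Self-reciprocal polynomials and their trace polynomials. -/

theorem reflect_X_sq_add_one_pow {K : Type*} [Field K] (m : ℕ) :
    ((X ^ 2 + 1 : K[X]) ^ m).reflect (2 * m) = (X ^ 2 + 1) ^ m := by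
  induction m with
  | zero => simp
  | succ m ih =>
    have h1 : (X ^ 2 + 1 : K[X]).natDegree ≤ 2 := by compute_degree
    have h2 : ((X ^ 2 + 1 : K[X]) ^ m).natDegree ≤ 2 * m := by
      rw [mul_comm]; exact natDegree_pow_le_of_le m h1
    have h3 : (X ^ 2 + 1 : K[X]).reflect 2 = X ^ 2 + 1 := by
      rw [reflect_add]
      have e1 : (X ^ 2 : K[X]).reflect 2 = 1 := by
        simp
      have e2 : (1 : K[X]).reflect 2 = X ^ 2 := by
        simp
      rw [e1, e2, add_comm]
    rw [mul_add, mul_one, pow_succ, reflect_mul _ _ h2 h1, ih, h3]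

/-- A polynomial `f` of degree at most `2 m` with symmetric coefficients is
`T ^ m * P (T + 1 / T)` for a polynomial `P` of degree at most `m`. -/
theorem exists_trace_polynomial {K : Type u} [Field K] (m : ℕ) :
    ∀ f : K[X], f.natDegree ≤ 2 * m → f.reflect (2 * m) = f →
      ∃ P : K[X], P.natDegree ≤ m ∧ P.coeff m = f.coeff (2 * m) ∧
        -- The extension `F` is free because two choices are needed: `K` itself, to evaluate at `1`
        -- and `-1`, and the field of rational functions, to compare polynomials.
        ∀ (F : Type u) [Field F] [Algebra K F] (x : F), x ≠ 0 →
          aeval x f = x ^ m * aeval ((x ^ 2 + 1) / x) P := by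
  induction m with
  | zero =>
    intro f hf _
    refine ⟨f, hf, rfl, fun F _ _ x _ => ?_⟩
    rw [eq_C_of_natDegree_le_zero hf]
    simp
  | succ m ih =>
    intro f hf hr
    set c := f.coeff (2 * (m + 1)) with hc
    -- Removing `c (X² + 1)^(m+1)` kills the top coefficient and, by symmetry, the constant one; so
    -- `g` is `X` times a symmetric polynomial for `2m`.
    set g := f - C c * (X ^ 2 + 1) ^ (m + 1) with hg
    have hd1 : (X ^ 2 + 1 : K[X]).natDegree ≤ 2 := by compute_degree
    have hd : ((X ^ 2 + 1 : K[X]) ^ (m + 1)).natDegree ≤ 2 * (m + 1) := by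
      rw [mul_comm]; exact natDegree_pow_le_of_le _ hd1
    have hlead : ((X ^ 2 + 1 : K[X]) ^ (m + 1)).coeff (2 * (m + 1)) = 1 := by
      rw [mul_comm 2 (m + 1), coeff_pow_of_natDegree_le hd1]
      simp [coeff_one]
    have hgr : g.reflect (2 * (m + 1)) = g := by
      rw [hg, reflect_sub, hr, reflect_C_mul, reflect_X_sq_add_one_pow]
    have hgtop : ∀ j, 2 * (m + 1) ≤ j → g.coeff j = 0 := by
      intro j hj
      rcases hj.eq_or_lt with rfl | hj
      · rw [hg, coeff_sub, coeff_C_mul, hlead, mul_one, sub_self]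
      · exact coeff_eq_zero_of_natDegree_lt
          (lt_of_le_of_lt ((natDegree_sub_le _ _).trans
            (max_le hf ((natDegree_C_mul_le _ _).trans hd))) hj)
    have hgsymm : ∀ j, j ≤ 2 * (m + 1) → g.coeff (2 * (m + 1) - j) = g.coeff j := by
      intro j hj
      conv_rhs => rw [← hgr]
      rw [coeff_reflect, revAt_le hj]
    have hg0 : g.coeff 0 = 0 := by
      rw [← hgsymm 0 (by omega)]; exact hgtop _ (by omega)
    have hgX : g = X * g.divX := by
      conv_lhs => rw [← divX_mul_X_add g, hg0]
      rw [C_0, add_zero, mul_comm]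
    have h1d : g.divX.natDegree ≤ 2 * m := by
      rw [natDegree_le_iff_coeff_eq_zero]
      intro j hj
      rw [coeff_divX]; exact hgtop _ (by omega)
    have h1r : g.divX.reflect (2 * m) = g.divX := by
      ext j
      rw [coeff_reflect]
      rcases le_or_gt j (2 * m) with hj | hj
      · rw [revAt_le hj, coeff_divX, coeff_divX, ← hgsymm (j + 1) (by omega)]
        congr 1; omega
      · rw [revAt_eq_self_of_lt hj]
    obtain ⟨P, hP, -, hPe⟩ := ih g.divX h1d h1r
    refine ⟨C c * X ^ (m + 1) + P, ?_, ?_, fun F _ _ x hx => ?_⟩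
    · refine natDegree_add_le_of_degree_le (natDegree_C_mul_X_pow_le _ _) (by omega)
    · rw [coeff_add, coeff_C_mul_X_pow, if_pos rfl,
        coeff_eq_zero_of_natDegree_lt (n := m + 1) (by omega), add_zero]
    · have hfe : f = C c * (X ^ 2 + 1) ^ (m + 1) + X * g.divX := by
        rw [← hgX, hg]; ring
      rw [hfe]
      simp only [map_add, map_mul, map_pow, aeval_X, aeval_C, map_one]
      rw [hPe F x hx]
      have hy : x ^ 2 + 1 = x * ((x ^ 2 + 1) / x) := (mul_div_cancel₀ _ hx).symm
      generalize (x ^ 2 + 1) / x = y at hy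
      rw [hy]
      ring

/-! ### Realising a self-reciprocal polynomial by an isometry. -/

/-- `f` is the characteristic polynomial of an isometry of a non-degenerate symmetric form. -/
def IsIsometryCharpoly {K : Type*} [Field K] (f : K[X]) : Prop :=
  ∃ (ι : Type) (_ : Fintype ι) (_ : DecidableEq ι) (G A : Matrix ι ι K),
    G.IsSymm ∧ G.det ≠ 0 ∧ A.transpose * G * A = G ∧ A.charpoly = f

theorem IsIsometryCharpoly.mul {K : Type*} [Field K] {f g : K[X]} (hf : IsIsometryCharpoly f)
    (hg : IsIsometryCharpoly g) : IsIsometryCharpoly (f * g) := by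
  obtain ⟨ι, _, _, G, A, hs, hd, hi, rfl⟩ := hf
  obtain ⟨κ, _, _, H, B, hs', hd', hi', rfl⟩ := hg
  refine ⟨ι ⊕ κ, inferInstance, inferInstance, Matrix.fromBlocks G 0 0 H,
    Matrix.fromBlocks A 0 0 B, ?_, ?_, ?_, ?_⟩
  · exact Matrix.IsSymm.fromBlocks hs (by simp) hs'
  · rw [Matrix.det_fromBlocks_zero₂₁]; exact mul_ne_zero hd hd'
  · simp [Matrix.fromBlocks_transpose, Matrix.fromBlocks_multiply, hi, hi']
  · simp

theorem isIsometryCharpoly_X_sub_C {K : Type*} [Field K] (a : K) (ha : a * a = 1) :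
    IsIsometryCharpoly (X - C a) := by
  refine ⟨Fin 1, inferInstance, inferInstance, 1, Matrix.diagonal fun _ => a, ?_, ?_, ?_, ?_⟩
  · exact Matrix.isSymm_one
  · simp
  · simp [ha]
  · simp [Matrix.charpoly, Matrix.charmatrix]

theorem isIsometryCharpoly_one {K : Type*} [Field K] : IsIsometryCharpoly (1 : K[X]) :=
  ⟨Fin 0, inferInstance, inferInstance, 1, 1, Matrix.isSymm_one, by simp, by simp, by simp⟩

/-- Every monic polynomial is the characteristic polynomial of a matrix that is self-adjoint
for a non-degenerate symmetric form. -/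
theorem exists_symm_matrix_of_monic {K : Type*} [Field K] (P : K[X]) (hP : P.Monic)
    (h0 : P.natDegree ≠ 0) :
    ∃ (n : ℕ) (G S : Matrix (Fin n) (Fin n) K), n = P.natDegree ∧ G.IsSymm ∧ G.det ≠ 0 ∧
      (G * S).IsSymm ∧ S.charpoly = P := by
  set pb := AdjoinRoot.powerBasis hP.ne_zero with hpb
  have hdim : pb.dim = P.natDegree := rfl
  have hgen : pb.gen = AdjoinRoot.root P := rfl
  have hpos : pb.dim - 1 < pb.dim := by omega
  -- The form is `(x, y) ↦ lam (x y)` on `K[X]/(P)`, with `lam` the coefficient of the top power of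
  -- the root; multiplication by the root is self-adjoint for it.
  set lam := pb.basis.coord ⟨pb.dim - 1, hpos⟩ with hlam
  have hlamp : ∀ k, k < pb.dim → lam (pb.gen ^ k) = if k = pb.dim - 1 then 1 else 0 := by
    intro k hk
    have := pb.basis_eq_pow ⟨k, hk⟩
    rw [← this, hlam, Module.Basis.coord_apply, Module.Basis.repr_self, Finsupp.single_apply]
    simp
  set G : Matrix (Fin pb.dim) (Fin pb.dim) K := Matrix.of fun i j =>
    lam (pb.gen ^ (i : ℕ) * pb.gen ^ (j : ℕ)) with hG
  set S := Algebra.leftMulMatrix pb.basis pb.gen with hS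
  have hGS : ∀ i j, (G * S) i j = lam (pb.gen ^ (i : ℕ) * (pb.gen * pb.gen ^ (j : ℕ))) := by
    intro i j
    have h1 : pb.gen * pb.gen ^ (j : ℕ) = ∑ k, S k j • pb.gen ^ (k : ℕ) := by
      have := pb.basis.sum_repr (pb.gen * pb.basis j)
      simp only [pb.basis_eq_pow] at this
      rw [← this]
      simp only [hS, Algebra.leftMulMatrix_eq_repr_mul, pb.basis_eq_pow]
    rw [h1, Finset.mul_sum, map_sum, Matrix.mul_apply]
    refine Finset.sum_congr rfl fun k _ => ?_
    rw [mul_smul_comm, map_smul, smul_eq_mul, mul_comm]; rfl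
  refine ⟨pb.dim, G, S, hdim, ?_, ?_, ?_, ?_⟩
  · ext i j; simp only [Matrix.transpose_apply, hG, Matrix.of_apply, mul_comm]
  -- The Gram matrix has entries `lam (x^(i+j))`: zero before the antidiagonal and one on it.
  -- Reversing the rows makes it unitriangular.
  · have htri : (G.submatrix Fin.revPerm id).det = 1 := by
      rw [Matrix.det_of_isUpperTriangular]
      · refine Finset.prod_eq_one fun i _ => ?_
        simp only [Matrix.submatrix_apply, hG, Matrix.of_apply, id, ← pow_add]
        rw [hlamp _ (by simp [Fin.val_rev]; omega), if_pos (by simp [Fin.val_rev]; omega)]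
      · intro i j hij
        have hij' : (j : ℕ) < i := hij
        simp only [Matrix.submatrix_apply, hG, Matrix.of_apply, id, ← pow_add]
        rw [hlamp _ (by simp [Fin.val_rev]; omega), if_neg (by simp [Fin.val_rev]; omega)]
    intro h
    have := Matrix.det_permute Fin.revPerm G
    rw [h, mul_zero] at this
    rw [this] at htri
    exact zero_ne_one htri
  · ext i j
    rw [Matrix.transpose_apply, hGS, hGS]
    congr 1; ring
  · rw [hS, charpoly_leftMulMatrix, hgen, AdjoinRoot.minpoly_root hP.ne_zero, hP.leadingCoeff]
    simp

/-- Think of pairs as `x + γ y` with `γ² = Sγ - 1`. Multiplication by `γ` is the block matrix `(0,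
-1; 1, S)`. The invariant form pairs each of the two copies with itself by `2G` and the two copies
with each other by `GS`, since `1 + 1 = 2` and `γ + γ⁻¹ = S`. -/
theorem isIsometryCharpoly_of_symm {K : Type u} [Field K] (f P : K[X]) {m : ℕ}
    (G S : Matrix (Fin m) (Fin m) K) (hG : G.IsSymm) (hGd : G.det ≠ 0) (hGS : (G * S).IsSymm)
    (hS : S.charpoly = P)
    (hf : ∀ (F : Type u) [Field F] [Algebra K F] (x : F), x ≠ 0 →
          aeval x f = x ^ m * aeval ((x ^ 2 + 1) / x) P)
    (h1 : P.eval 2 ≠ 0) (h2 : P.eval (-2) ≠ 0) : IsIsometryCharpoly f := by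
  have hSG : S.transpose * G = G * S := by
    have := hGS.eq
    rwa [Matrix.transpose_mul, hG.eq] at this
  have hSGS : G * S * S = S.transpose * (G * S) := by
    rw [← Matrix.mul_assoc, hSG]
  refine ⟨Fin m ⊕ Fin m, inferInstance, inferInstance,
    Matrix.fromBlocks ((2 : K) • G) (G * S) (G * S) ((2 : K) • G),
    Matrix.fromBlocks 0 (-1) 1 S, ?_, ?_, ?_, ?_⟩
  · exact Matrix.IsSymm.fromBlocks (hG.smul _) hGS.eq (hG.smul _)
  -- The product is block diagonal with blocks `G(2 - S)(2 + S)`, whose determinant is `det G · P(2)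
  -- P(-2)` up to sign.
  · have e : Matrix.fromBlocks ((2 : K) • G) (G * S) (G * S) ((2 : K) • G) *
        Matrix.fromBlocks ((2 : K) • 1) (-S) (-S) ((2 : K) • 1) =
        Matrix.fromBlocks (G * ((Matrix.scalar _ 2 - S) * -(Matrix.scalar _ (-2) - S))) 0 0
          (G * ((Matrix.scalar _ 2 - S) * -(Matrix.scalar _ (-2) - S))) := by
      have hs : (Matrix.scalar (Fin m) (2 : K)) = (2 : K) • 1 := by
        rw [Matrix.smul_one_eq_diagonal]; rfl
      have hs' : (Matrix.scalar (Fin m) (-2 : K)) = -((2 : K) • 1) := by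
        rw [map_neg, hs]
      rw [hs, hs', Matrix.fromBlocks_multiply]
      congr 1 <;>
        simp [Matrix.mul_add, Matrix.sub_mul, Matrix.mul_assoc, Matrix.mul_sub, two_smul,
          Matrix.add_mul] <;> abel
    intro h
    have hdet := congrArg Matrix.det e
    rw [Matrix.det_mul, h, zero_mul, Matrix.det_fromBlocks_zero₂₁, Matrix.det_mul, Matrix.det_mul,
      Matrix.det_neg, ← Matrix.eval_charpoly, ← Matrix.eval_charpoly, hS] at hdet
    have hu : ((-1 : K)) ^ Fintype.card (Fin m) ≠ 0 := pow_ne_zero _ (by simp)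
    have := mul_ne_zero hGd (mul_ne_zero h1 (mul_ne_zero hu h2))
    exact mul_ne_zero this this hdet.symm
  · rw [Matrix.fromBlocks_transpose, Matrix.fromBlocks_multiply, Matrix.fromBlocks_multiply]
    congr 1 <;>
      simp [Matrix.mul_add, Matrix.add_mul, hSG, two_smul, hSGS]
  -- In the rational function field `X` is invertible, so the Schur complement of the block `x • 1`
  -- is `x + x⁻¹ - S`.
  · set F := FractionRing K[X]
    have hinj : Function.Injective (algebraMap K[X] F) := IsFractionRing.injective _ _
    set x : F := algebraMap K[X] F X with hx
    have hx0 : x ≠ 0 := by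
      rw [hx, Ne, map_eq_zero_iff _ hinj]; exact X_ne_zero
    have hae : ∀ g : K[X], aeval x g = algebraMap K[X] F g := by
      intro g
      rw [hx, aeval_algebraMap_apply, aeval_X_left_apply]
    apply hinj
    rw [← hae, ← hae, hf F x hx0, ← hS]
    have key : ∀ {κ : Type} [Fintype κ] [DecidableEq κ] (M : Matrix κ κ K) (y : F),
        aeval y M.charpoly = (Matrix.scalar κ y - M.map (algebraMap K F)).det := by
      intro κ _ _ M y
      rw [← Matrix.eval_charpoly, Matrix.charpoly_map, eval_map_algebraMap]
    rw [key, key]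
    have e : Matrix.scalar (Fin m ⊕ Fin m) x -
        (Matrix.fromBlocks (0 : Matrix (Fin m) (Fin m) K) (-1) 1 S).map (algebraMap K F) =
        Matrix.fromBlocks (x • 1) 1 (-1) (x • 1 - S.map (algebraMap K F)) := by
      ext i j
      rcases i with i | i <;> rcases j with j | j <;>
        simp [Matrix.diagonal_apply, Matrix.one_apply, Matrix.smul_apply]
    rw [e]
    let _ : Invertible (x • (1 : Matrix (Fin m) (Fin m) F)) :=
      ⟨x⁻¹ • 1, by simp [hx0], by simp [hx0]⟩
    rw [Matrix.det_fromBlocks₁₁]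
    have hinv : ⅟(x • (1 : Matrix (Fin m) (Fin m) F)) = x⁻¹ • 1 := rfl
    rw [hinv, Matrix.det_smul, Matrix.det_one, mul_one, Fintype.card_fin]
    congr 2
    have hs : (Matrix.scalar (Fin m) ((x ^ 2 + 1) / x)) = (x + x⁻¹) • 1 := by
      rw [Matrix.smul_one_eq_diagonal, show (x ^ 2 + 1) / x = x + x⁻¹ by
      rw [div_eq_iff hx0, add_mul, inv_mul_cancel₀ hx0]; ring]; rfl
    rw [hs]
    simp [add_smul]
    abel

theorem reverse_X_sub_C_of_mul_self_eq_one {K : Type*} [Field K] (a : K) (ha : a * a = 1) :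
    (X - C a : K[X]).reverse = C (-a) * (X - C a) := by
  have e1 : (X : K[X]).reflect 1 = 1 := by
    have := reflect_monomial 1 1 (R := K)
    rwa [pow_one, revAt_le le_rfl, Nat.sub_self, pow_zero] at this
  rw [reverse, natDegree_X_sub_C, reflect_sub, e1, reflect_C, pow_one, mul_sub, ← C_mul,
    neg_mul, ha, C_neg, C_neg, C_1]
  ring

/-- A monic polynomial with `T ^ N * f (1 / T) = ± f T` is the characteristic polynomial of an
isometry. -/
theorem isIsometryCharpoly_of_reverse {K : Type u} [Field K] (h2 : (2 : K) ≠ 0) (n : ℕ) :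
    ∀ f : K[X], f.natDegree = n → f.Monic →
      (∃ ε : K, (ε = 1 ∨ ε = -1) ∧ f.reverse = C ε * f) → IsIsometryCharpoly f := by
  induction n using Nat.strong_induction_on with
  | _ n ih =>
  intro f hfn hfm ⟨ε, hε, hrev⟩
  have hroot : ∀ a : K, a * a = 1 → f.eval a = 0 → IsIsometryCharpoly f := by
    intro a ha hfa
    obtain ⟨g, rfl⟩ := dvd_iff_isRoot.mpr hfa
    have hgm : g.Monic := (monic_X_sub_C a).of_mul_monic_left hfm
    refine (isIsometryCharpoly_X_sub_C a ha).mul (ih g.natDegree ?_ g rfl hgm ?_)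
    · rw [← hfn, (monic_X_sub_C a).natDegree_mul hgm, natDegree_X_sub_C]; omega
    · rw [reverse_mul_of_domain, reverse_X_sub_C_of_mul_self_eq_one a ha] at hrev
      have h : (X - C a) * (C (-a) * g.reverse) = (X - C a) * (C ε * g) := by
        linear_combination hrev
      have h' := mul_left_cancel₀ (X_sub_C_ne_zero a) h
      refine ⟨-a * ε, ?_, ?_⟩
      · rcases mul_self_eq_one_iff.mp ha with rfl | rfl <;> rcases hε with rfl | rfl <;> simp
      · have e : (C (-a) * C (-a) : K[X]) = 1 := by rw [← C_mul, neg_mul_neg, ha, C_1]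
        rw [C_mul, mul_assoc, ← h', ← mul_assoc, e, one_mul]
  by_cases h1 : f.eval 1 = 0
  · exact hroot 1 (by ring) h1
  by_cases hm1 : f.eval (-1) = 0
  · exact hroot (-1) (by ring) hm1
  -- With `f(1)` and `f(-1)` nonzero, evaluation at `1` forces the sign to be `1`, and evaluation at
  -- `-1` then forces the degree to be even.
  have hε1 : ε = 1 := by
    let _ : Invertible (1 : K) := ⟨1, by ring, by ring⟩
    have hinv : ⅟(1 : K) = 1 := rfl
    have := eval₂_reverse_mul_pow (RingHom.id K) 1 f
    rw [hrev, hinv, one_pow, mul_one, ← eval, ← eval, eval_mul, eval_C] at this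
    exact mul_right_cancel₀ h1 (this.trans (one_mul _).symm)
  subst hε1
  have heven : Even n := by
    by_contra hodd
    rw [Nat.not_even_iff_odd] at hodd
    let _ : Invertible (-1 : K) := ⟨-1, by ring, by ring⟩
    have := eval₂_reverse_mul_pow (RingHom.id K) (-1) f
    have hinv : ⅟(-1 : K) = -1 := rfl
    rw [hrev, hinv, hfn, hodd.neg_one_pow, ← eval, ← eval, eval_mul, eval_C, one_mul] at this
    have h4 : 2 * f.eval (-1) = 0 := by linear_combination -this
    exact (mul_ne_zero h2 hm1) h4
  obtain ⟨m, hm⟩ := heven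
  obtain ⟨P, hPd, hPc, hPe⟩ := exists_trace_polynomial m f (by omega) (by
    rw [show 2 * m = f.natDegree by omega]
    simpa [reverse] using hrev)
  rcases Nat.eq_zero_or_pos m with rfl | hmpos
  · have : f = 1 := by
      rw [← hfm.natDegree_eq_zero]; omega
    rw [this]; exact isIsometryCharpoly_one
  have hc1 : P.coeff m = 1 := by
    rw [hPc, show 2 * m = f.natDegree by omega]; exact hfm
  have hPm : P.Monic := monic_of_natDegree_le_of_coeff_eq_one m hPd hc1
  have hPn : P.natDegree = m :=
    le_antisymm hPd (le_natDegree_of_ne_zero (by rw [hc1]; exact one_ne_zero))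
  obtain ⟨k, G, S, hk, hG, hGd, hGS, hS⟩ := exists_symm_matrix_of_monic P hPm (by omega)
  obtain rfl : k = m := by omega
  refine isIsometryCharpoly_of_symm f P G S hG hGd hGS hS hPe ?_ ?_
  · have := hPe K 1 one_ne_zero
    norm_num [coe_aeval_eq_eval] at this
    rwa [← this]
  · have := hPe K (-1) (by simp)
    norm_num [coe_aeval_eq_eval] at this
    intro h
    rw [h, mul_zero] at this
    exact hm1 this

theorem exists_isometry_charpoly_eq {K : Type u} [Field K] (h2 : (2 : K) ≠ 0) (N : ℕ) (f : K[X])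
    (hf : f.Monic) (hN : f.natDegree = N) (hfe : SatisfiesFunctionalEquation N f) :
    ∃ Ψ : LinearMap.BilinForm K (Fin N → K), Ψ.IsSymm ∧ Ψ.Nondegenerate ∧
      ∃ γ : orthogonalGroup Ψ, (toEnd γ).charpoly = f := by
  obtain ⟨ι, _, _, G, A, hs, hd, hi, hA⟩ :=
    isIsometryCharpoly_of_reverse h2 N f hN hf (by rw [reverse, hN]; exact hfe)
  have hcard : Fintype.card ι = N := by
    rw [← hN, ← hA, Matrix.charpoly_natDegree_eq_dim]
  let e : ι ≃ Fin N := Fintype.equivFinOfCardEq hcard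
  set G' := Matrix.reindex e e G with hG'
  set A' := Matrix.reindex e e A with hA'
  have hs' : G'.IsSymm := by
    rw [Matrix.IsSymm, hG', Matrix.transpose_reindex, hs.eq]
  have hd' : G'.det ≠ 0 := by rwa [hG', Matrix.det_reindex_self]
  have hi' : A'.transpose * G' * A' = G' := by
    rw [hG', hA', Matrix.transpose_reindex]
    simp only [Matrix.reindex_apply, Matrix.submatrix_mul_equiv, hi]
  have hAdet : IsUnit A'.det := by
    rw [isUnit_iff_ne_zero]
    intro h
    have := congrArg Matrix.det hi'
    rw [Matrix.det_mul, h, mul_zero] at this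
    exact hd' this.symm
  refine ⟨Matrix.toBilin' G', ?_, ?_, ⟨Matrix.toLinearEquiv' A' (A'.invertibleOfIsUnitDet hAdet),
    fun x y => ?_⟩, ?_⟩
  · exact Matrix.isSymm_toBilin'_iff_isSymm.mpr hs'
  · rw [LinearMap.BilinForm.nondegenerate_toBilin'_iff_det_ne_zero]; exact hd'
  · have e1 : ∀ z, (Matrix.toLinearEquiv' A' (A'.invertibleOfIsUnitDet hAdet)) z =
      Matrix.toLin' A' z := fun z => rfl
    rw [e1, e1, ← LinearMap.BilinForm.comp_apply, Matrix.toBilin'_comp, hi']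
  · change (Matrix.toLin' A').charpoly = f
    rw [Matrix.charpoly_toLin', hA', Matrix.charpoly_reindex, hA]

/-! ### The discriminant of a space with an isometry without eigenvalues `1` and `-1`. -/

/-- A nonzero entry `a` gives an invertible `2 × 2` principal block of determinant `a²`; its Schur
complement is again skew, so induction on the size applies. -/
theorem det_isSquare_of_transpose_eq_neg {K : Type*} [Field K] (h2 : (2 : K) ≠ 0) (n : ℕ) :
    ∀ (ι : Type) [Fintype ι] [DecidableEq ι], Fintype.card ι = n →
      ∀ A : Matrix ι ι K, A.transpose = -A → IsSquare A.det := by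
  induction n using Nat.strong_induction_on with
  | _ n ih =>
  intro ι _ _ hn A hA
  have hA' : ∀ i j, A j i = -A i j := fun i j => congrFun (congrFun hA i) j
  have hdiag : ∀ i, A i i = 0 := by
    intro i
    have h : 2 * A i i = 0 := by linear_combination hA' i i
    exact (mul_eq_zero.mp h).resolve_left h2
  by_cases h0 : A = 0
  · subst h0
    rcases isEmpty_or_nonempty ι with h | h
    · simp
    · simp
  obtain ⟨i, j, hij⟩ : ∃ i j, A i j ≠ 0 := by
    by_contra! h
    exact h0 (Matrix.ext h)
  have hne : i ≠ j := by
    rintro rfl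
    exact hij (hdiag i)
  have hcard : Fintype.card ι = Fintype.card (Fin 2 ⊕ Fin (n - 2)) := by
    have : 1 < Fintype.card ι := Fintype.one_lt_card_iff.mpr ⟨i, j, hne⟩
    rw [Fintype.card_sum, Fintype.card_fin, Fintype.card_fin]
    omega
  obtain ⟨e, he0, he1⟩ : ∃ e : Fin 2 ⊕ Fin (n - 2) ≃ ι, e (.inl 0) = i ∧ e (.inl 1) = j := by
    let e0 : Fin 2 ⊕ Fin (n - 2) ≃ ι := (Fintype.equivOfCardEq hcard).symm
    let e1 := e0.trans (Equiv.swap (e0 (.inl 0)) i)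
    have h10 : e1 (.inl 0) = i := by simp [e1]
    refine ⟨e1.trans (Equiv.swap (e1 (.inl 1)) j), ?_, by simp⟩
    rw [Equiv.trans_apply, h10]
    refine Equiv.swap_apply_of_ne_of_ne ?_ hne
    rw [← h10]
    exact fun h => by simpa using e1.injective h
  rw [← Matrix.det_submatrix_equiv_self e A]
  set B := A.submatrix e e with hB
  have hBt : B.transpose = -B := by
    rw [hB, Matrix.transpose_submatrix, hA]; rfl
  rw [← Matrix.fromBlocks_toBlocks B] at hBt ⊢
  rw [Matrix.fromBlocks_transpose, Matrix.fromBlocks_neg, Matrix.fromBlocks_inj] at hBt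
  obtain ⟨t11, t21, t12, t22⟩ := hBt
  have hJ : B.toBlocks₁₁.det = A i j * A i j := by
    rw [Matrix.det_fin_two]
    simp only [Matrix.toBlocks₁₁, hB, Matrix.of_apply, Matrix.submatrix_apply, he0, he1, hdiag]
    rw [hA' i j]; ring
  have hu : IsUnit B.toBlocks₁₁.det := by
    rw [hJ, isUnit_iff_ne_zero]; exact mul_ne_zero hij hij
  let _ := B.toBlocks₁₁.invertibleOfIsUnitDet hu
  rw [Matrix.det_fromBlocks₁₁, hJ, Matrix.invOf_eq_nonsing_inv]
  refine (IsSquare.mul_self _).mul (ih (n - 2) (by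
    have : 1 < Fintype.card ι := Fintype.one_lt_card_iff.mpr ⟨i, j, hne⟩
    omega) (Fin (n - 2)) (Fintype.card_fin _) _ ?_)
  have hinv : (B.toBlocks₁₁)⁻¹.transpose = -(B.toBlocks₁₁)⁻¹ := by
    rw [Matrix.transpose_nonsing_inv, t11]
    exact Matrix.inv_eq_right_inv (by rw [neg_mul_neg, Matrix.mul_nonsing_inv _ hu])
  rw [Matrix.transpose_sub, Matrix.transpose_mul, Matrix.transpose_mul, t22, t12, t21, hinv]
  simp [Matrix.mul_assoc]
  abel

theorem hasDet_of_isometry_charpoly {K : Type*} [Field K] (h2 : (2 : K) ≠ 0) {f : K[X]} {V : Type*}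
    [AddCommGroup V] [Module K V] [FiniteDimensional K V] (Ψ : LinearMap.BilinForm K V)
    (hN : Even (Module.finrank K V)) (hs : Ψ.IsSymm) (hd : Ψ.Nondegenerate)
    (γ : orthogonalGroup Ψ) (hγ : (toEnd γ).charpoly = f) (h1 : f.eval 1 ≠ 0)
    (hm1 : f.eval (-1) ≠ 0) : HasDet Ψ (f.eval (-1) * f.eval 1) := by
  set b := Module.finBasis K V with hb
  refine ⟨b, ?_⟩
  set G := LinearMap.BilinForm.toMatrix b Ψ with hG
  set A := LinearMap.toMatrix b b (toEnd γ) with hA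
  have hGs : G.transpose = G := ((LinearMap.BilinForm.isSymm_toMatrix_iff_isSymm b).mpr hs).eq
  have hGd : G.det ≠ 0 := (LinearMap.BilinForm.nondegenerate_iff_det_ne_zero b).mp hd
  have hAG : A.transpose * G * A = G := by
    rw [hA, hG, ← LinearMap.BilinForm.toMatrix_comp]
    congr 1
    ext x y
    exact γ.2 x y
  have hAf : A.charpoly = f := by rw [hA, LinearMap.charpoly_toMatrix, hγ]
  have hf1 : (1 - A).det = f.eval 1 := by
    rw [← hAf, Matrix.eval_charpoly, map_one]
  have hfm : (1 + A).det = f.eval (-1) := by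
    rw [← hAf, Matrix.eval_charpoly, map_neg, map_one, ← neg_add', Matrix.det_neg,
      Fintype.card_fin, hN.neg_one_pow, one_mul]
  have hdet : A.det = 1 := by
    -- Taking determinants gives `det(1 - A) det G det A = (-1)^N det G det(1 - A)`, and the nonzero
    -- factors cancel.
    have e : (1 - A).transpose * G * A = -(G * (1 - A)) := by
      rw [Matrix.transpose_sub, Matrix.sub_mul, Matrix.sub_mul, hAG, Matrix.transpose_one,
        Matrix.one_mul, Matrix.mul_sub, Matrix.mul_one]
      abel
    have := congrArg Matrix.det e
    rw [Matrix.det_mul, Matrix.det_mul, Matrix.det_neg, Matrix.det_transpose, Fintype.card_fin,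
      hN.neg_one_pow, one_mul, Matrix.det_mul, hf1] at this
    refine mul_left_cancel₀ (mul_ne_zero h1 hGd) ?_
    linear_combination this
  obtain ⟨u, hu⟩ := det_isSquare_of_transpose_eq_neg h2 _ _ rfl (A.transpose * G - G * A) (by
    rw [Matrix.transpose_sub, Matrix.transpose_mul, Matrix.transpose_mul, Matrix.transpose_transpose,
      hGs, neg_sub])
  have e : (A.transpose * G - G * A) * A = G * ((1 - A) * (1 + A)) := by
    rw [Matrix.sub_mul, hAG]
    simp [Matrix.sub_mul, Matrix.mul_add, Matrix.mul_sub, Matrix.mul_assoc]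
  have := congrArg Matrix.det e
  rw [Matrix.det_mul, hdet, mul_one, Matrix.det_mul, Matrix.det_mul, hf1, hfm, hu] at this
  have hu0 : u ≠ 0 := by
    rintro rfl
    rw [zero_mul] at this
    exact mul_ne_zero hGd (mul_ne_zero h1 hm1) this.symm
  refine ⟨u / (f.eval 1 * f.eval (-1)), div_ne_zero hu0 (mul_ne_zero h1 hm1), ?_⟩
  field_simp
  linear_combination -this

theorem exists_pow_eq {K : Type*} [Field K] [Finite K] (g : Kˣ) (hg : ∀ x : Kˣ, x ∈ Subgroup.zpowers g) (c : K)
    (hc : c ≠ 0) : ∃ a : ℕ, c = (g : K) ^ a := by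
  obtain ⟨a, ha⟩ := mem_powers_iff_mem_zpowers.mpr (hg (Units.mk0 c hc))
  exact ⟨a, by simpa using (congrArg Units.val ha).symm⟩

/-! ### Reflections, generation of the orthogonal group and the quotient `O/Ω`. -/

section Reflections

variable {K : Type*} [Field K] {V : Type*} [AddCommGroup V] [Module K V]
  {Ψ : LinearMap.BilinForm K V}

theorem orthogonalGroup_ext {g h : orthogonalGroup Ψ} (H : ∀ x, g.1 x = h.1 x) : g = h :=
  Subtype.ext (LinearEquiv.ext H)

theorem two_div_smul_apply_self (v : V) (hv : Ψ v v ≠ 0) : ((2 / Ψ v v) • Ψ v) v = 2 := by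
  simp [hv]

/-- The reflection of `(V, Ψ)` in the hyperplane orthogonal to an anisotropic vector. -/
def hyperplaneReflection (hs : Ψ.IsSymm) (v : V) (hv : Ψ v v ≠ 0) : orthogonalGroup Ψ :=
  ⟨Module.reflection (two_div_smul_apply_self v hv), fun x y => by
    simp only [Module.reflection_apply, map_sub, map_smul, LinearMap.sub_apply,
      LinearMap.smul_apply, smul_eq_mul]
    rw [hs.eq x v]
    field_simp
    ring⟩

theorem hyperplaneReflection_apply (hs : Ψ.IsSymm) (v : V) (hv : Ψ v v ≠ 0) (x : V) :
    (hyperplaneReflection hs v hv).1 x = x - (2 / Ψ v v * Ψ v x) • v :=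
  Module.reflection_apply x (two_div_smul_apply_self v hv)

theorem hyperplaneReflection_mul_self (hs : Ψ.IsSymm) (v : V) (hv : Ψ v v ≠ 0) :
    hyperplaneReflection hs v hv * hyperplaneReflection hs v hv = 1 :=
  Subtype.ext (LinearEquiv.ext fun x => Module.involutive_reflection (two_div_smul_apply_self v hv) x)

theorem hyperplaneReflection_conj (hs : Ψ.IsSymm) (v : V) (hv : Ψ v v ≠ 0) (g : orthogonalGroup Ψ)
    (hv' : Ψ (g.1 v) (g.1 v) ≠ 0) :
    g * hyperplaneReflection hs v hv = hyperplaneReflection hs (g.1 v) hv' * g := by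
  refine orthogonalGroup_ext fun x => ?_
  change g.1 ((hyperplaneReflection hs v hv).1 x) = (hyperplaneReflection hs _ hv').1 (g.1 x)
  rw [hyperplaneReflection_apply, hyperplaneReflection_apply, map_sub, map_smul, g.2, g.2]

theorem hyperplaneReflection_smul (hs : Ψ.IsSymm) (v : V) (hv : Ψ v v ≠ 0) (c : K)
    (hcv : Ψ (c • v) (c • v) ≠ 0) :
    hyperplaneReflection hs (c • v) hcv = hyperplaneReflection hs v hv := by
  have hc : c ≠ 0 := by
    rintro rfl
    simp at hcv
  refine orthogonalGroup_ext fun x => ?_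
  rw [hyperplaneReflection_apply, hyperplaneReflection_apply, smul_smul]
  simp only [map_smul, LinearMap.smul_apply, smul_eq_mul]
  congr 2
  field_simp

/-- The set of all hyperplane reflections of `(V, Ψ)`. -/
def hyperplaneReflections (hs : Ψ.IsSymm) : Set (orthogonalGroup Ψ) :=
  {g | ∃ (v : V) (hv : Ψ v v ≠ 0), g = hyperplaneReflection hs v hv}

/-- The norms of `u - v` and `u + v` add up to `4 Ψ v v`, so one of the two is anisotropic. The
reflection in `u - v` takes `u` to `v`; that in `u + v` takes `u` to `-v`, which the reflection in
`v` corrects. -/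
theorem exists_mem_closure_hyperplaneReflections_apply_eq (h2 : (2 : K) ≠ 0) (hs : Ψ.IsSymm)
    (u v : V) (huv : Ψ u u = Ψ v v) (hv : Ψ v v ≠ 0) :
    ∃ h ∈ Subgroup.closure (hyperplaneReflections hs), h.1 u = v ∧
      ∀ w, Ψ u w = 0 → Ψ v w = 0 → h.1 w = w := by
  have hvu : Ψ v u = Ψ u v := (hs.eq v u)
  by_cases h1 : Ψ (u - v) (u - v) = 0
  · have h3 : Ψ (u + v) (u + v) ≠ 0 := by
      intro h3
      simp only [map_add, map_sub, LinearMap.add_apply, LinearMap.sub_apply] at h1 h3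
      have : 2 * (2 * Ψ v v) = 0 := by linear_combination h1 + h3 - 2 * huv
      exact mul_ne_zero h2 (mul_ne_zero h2 hv) this
    refine ⟨hyperplaneReflection hs v hv * hyperplaneReflection hs (u + v) h3,
      mul_mem (Subgroup.subset_closure ⟨v, hv, rfl⟩) (Subgroup.subset_closure ⟨_, h3, rfl⟩), ?_, ?_⟩
    · change (hyperplaneReflection hs v hv).1 ((hyperplaneReflection hs (u + v) h3).1 u) = v
      have e : (hyperplaneReflection hs (u + v) h3).1 u = -v := by
        rw [hyperplaneReflection_apply]
        have : 2 / Ψ (u + v) (u + v) * Ψ (u + v) u = 1 := by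
          rw [div_mul_eq_mul_div, div_eq_one_iff_eq h3]
          simp only [map_add, LinearMap.add_apply]
          linear_combination huv + hvu
        rw [this, one_smul]; abel
      rw [e, map_neg, hyperplaneReflection_apply, div_mul_cancel₀ _ hv, two_smul]
      abel
    · intro w hu hv'
      change (hyperplaneReflection hs v hv).1 ((hyperplaneReflection hs (u + v) h3).1 w) = w
      rw [hyperplaneReflection_apply hs (u + v)]
      simp only [map_add, LinearMap.add_apply, hu, hv', add_zero, mul_zero, zero_smul, sub_zero]
      rw [hyperplaneReflection_apply, hv', mul_zero, zero_smul, sub_zero]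
  · refine ⟨hyperplaneReflection hs (u - v) h1, Subgroup.subset_closure ⟨_, h1, rfl⟩, ?_, ?_⟩
    · rw [hyperplaneReflection_apply]
      have : 2 / Ψ (u - v) (u - v) * Ψ (u - v) u = 1 := by
        rw [div_mul_eq_mul_div, div_eq_one_iff_eq h1]
        simp only [map_sub, LinearMap.sub_apply]
        linear_combination huv - hvu
      rw [this, one_smul]; abel
    · intro w hu hv'
      rw [hyperplaneReflection_apply]
      simp [hu, hv']

theorem closure_hyperplaneReflections [FiniteDimensional K V] (h2 : (2 : K) ≠ 0) (hs : Ψ.IsSymm)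
    (hd : Ψ.Nondegenerate) : Subgroup.closure (hyperplaneReflections hs) = ⊤ := by
  let _ : Invertible (2 : K) := invertibleOfNonzero h2
  obtain ⟨b, hb⟩ := LinearMap.BilinForm.exists_orthogonal_basis (B := Ψ) ⟨hs.eq⟩
  have hbo : ∀ i j, i ≠ j → Ψ (b i) (b j) = 0 := fun i j hij => hb hij
  have hbn : ∀ i, Ψ (b i) (b i) ≠ 0 := fun i h =>
    hb.not_isOrtho_basis_self_of_separatingLeft hd.1 i h
  generalize Module.finrank K V = n at b hb hbo hbn
  -- The number `k` counts the last vectors of an orthogonal basis that `g` may move. Each step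
  -- returns one of them to its place without disturbing the vectors already fixed.
  have key : ∀ k : ℕ, ∀ g : orthogonalGroup Ψ, (∀ i : Fin n, i.1 + k < n → g.1 (b i) = b i) →
      g ∈ Subgroup.closure (hyperplaneReflections hs) := by
    intro k
    induction k with
    | zero =>
      intro g hg
      have : g = 1 := by
        refine Subtype.ext (b.ext' fun i => ?_)
        exact hg i i.2
      rw [this]; exact one_mem _
    | succ k ih =>
      intro g hg
      by_cases hk : k < n
      · set i0 : Fin n := ⟨n - k - 1, by omega⟩ with hi0
        obtain ⟨h, hH, h1, h3⟩ := exists_mem_closure_hyperplaneReflections_apply_eq h2 hs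
          (g.1 (b i0)) (b i0) (g.2 _ _) (hbn i0)
        have := ih (h * g) fun i hi => by
          change h.1 (g.1 (b i)) = b i
          by_cases hii : i = i0
          · rw [hii, h1]
          · have hlt : i.1 + (k + 1) < n := by
              have : i.1 ≠ n - k - 1 := fun h => hii (Fin.ext h)
              omega
            have hgi := hg i hlt
            rw [hgi]
            refine h3 _ ?_ (hbo _ _ (Ne.symm hii))
            conv_lhs => rw [← hgi]
            rw [g.2, hbo _ _ (Ne.symm hii)]
        exact (Subgroup.mul_mem_cancel_left _ hH).mp this
      · exact ih g fun i hi => by omega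
  rw [eq_top_iff]
  intro g _
  exact key n g fun i hi => by omega

/-- After rescaling, the two vectors have equal norm, so an isometry carries one to the other; the
reflections are conjugate and agree in the abelianization. -/
theorem of_hyperplaneReflection_eq (h2 : (2 : K) ≠ 0) (hs : Ψ.IsSymm) (u v : V) (hu : Ψ u u ≠ 0)
    (hv : Ψ v v ≠ 0) (c : K) (huv : Ψ u u = c ^ 2 * Ψ v v) :
    Abelianization.of (hyperplaneReflection hs u hu) =
      Abelianization.of (hyperplaneReflection hs v hv) := by
  have h1 : Ψ (c • v) (c • v) = Ψ u u := by
    simp only [map_smul, LinearMap.smul_apply, smul_eq_mul]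
    rw [huv]; ring
  have hcv : Ψ (c • v) (c • v) ≠ 0 := by rwa [h1]
  obtain ⟨h, -, hh, -⟩ :=
    exists_mem_closure_hyperplaneReflections_apply_eq h2 hs (c • v) u h1 hu
  subst hh
  have := congrArg Abelianization.of (hyperplaneReflection_conj hs (c • v) hcv h hu)
  rw [map_mul, map_mul, mul_comm] at this
  rw [← mul_right_cancel this, hyperplaneReflection_smul hs v hv c hcv]

/-- The classes of reflections in `O / Ω`: they are involutions which depend only on the parity
of the discrete logarithm of the value of the form. -/
theorem exists_reflection_classes (h2 : (2 : K) ≠ 0) (hs : Ψ.IsSymm) (e f : V) (he : Ψ e e = 0)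
    (hf : Ψ f f = 0) (hef : Ψ e f = 1) (g : Kˣ) :
    ∃ ρ δ : Abelianization (orthogonalGroup Ψ), ρ * ρ = 1 ∧ δ * δ = 1 ∧
      ∀ (v : V) (hv : Ψ v v ≠ 0) (a : ℕ), Ψ v v = -2 * (g : K) ^ a →
        Abelianization.of (hyperplaneReflection hs v hv) = ρ * δ ^ a := by
  have hfe : Ψ f e = 1 := by rw [← hef]; exact hs.eq f e
  -- The norm of `e - s f` is `-2s`, whence the normalisation of norms as `-2 g^a`. The choices `s =
  -- 1` and `s = g` represent both square classes.
  have hval : ∀ s : K, Ψ (e - s • f) (e - s • f) = -2 * s := by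
    intro s
    simp only [map_sub, map_smul, LinearMap.sub_apply, LinearMap.smul_apply, smul_eq_mul, he, hf,
      hef, hfe]
    ring
  have h1 : Ψ (e - (1 : K) • f) (e - (1 : K) • f) ≠ 0 := by
    rw [hval]; simpa using h2
  have hg : Ψ (e - (g : K) • f) (e - (g : K) • f) ≠ 0 := by
    rw [hval]; simpa using h2
  set r1 := Abelianization.of (hyperplaneReflection hs _ h1)
  set rg := Abelianization.of (hyperplaneReflection hs _ hg)
  have hr1 : r1 * r1 = 1 := by rw [← map_mul, hyperplaneReflection_mul_self, map_one]
  have hrg : rg * rg = 1 := by rw [← map_mul, hyperplaneReflection_mul_self, map_one]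
  have hδ : (r1 * rg) * (r1 * rg) = 1 := by rw [mul_mul_mul_comm, hr1, hrg, one_mul]
  refine ⟨r1, r1 * rg, hr1, hδ, fun v hv a hva => ?_⟩
  rcases Nat.even_or_odd' a with ⟨c, rfl | rfl⟩
  · rw [pow_mul, sq, hδ, one_pow, mul_one]
    refine of_hyperplaneReflection_eq h2 hs _ _ _ _ ((g : K) ^ c) ?_
    rw [hva, hval]; ring
  · rw [pow_succ, pow_mul, sq, hδ, one_pow, one_mul, ← mul_assoc, hr1, one_mul]
    refine of_hyperplaneReflection_eq h2 hs _ _ _ _ ((g : K) ^ c) ?_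
    rw [hva, hval]; ring

theorem exists_of_eq_reflection_class [Finite K] [FiniteDimensional K V] (h2 : (2 : K) ≠ 0)
    (hs : Ψ.IsSymm)
    (hd : Ψ.Nondegenerate) (g : Kˣ) (hg : ∀ x : Kˣ, x ∈ Subgroup.zpowers g)
    (ρ δ : Abelianization (orthogonalGroup Ψ)) (hρ : ρ * ρ = 1) (hδ : δ * δ = 1)
    (hr : ∀ (v : V) (hv : Ψ v v ≠ 0) (a : ℕ), Ψ v v = -2 * (g : K) ^ a →
        Abelianization.of (hyperplaneReflection hs v hv) = ρ * δ ^ a) (α : orthogonalGroup Ψ) :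
    ∃ p : ℕ, Abelianization.of α = δ ^ p ∨ Abelianization.of α = ρ * δ ^ p := by
  have key : ∃ q p : ℕ, Abelianization.of α = ρ ^ q * δ ^ p := by
    have hmem : α ∈ Subgroup.closure (hyperplaneReflections hs) := by
      rw [closure_hyperplaneReflections h2 hs hd]; trivial
    induction hmem using Subgroup.closure_induction with
    | mem x hx =>
      obtain ⟨v, hv, rfl⟩ := hx
      have h0 : Ψ v v / (-2) ≠ 0 := div_ne_zero hv (by simpa using h2)
      obtain ⟨a, ha⟩ := exists_pow_eq g hg _ h0
      refine ⟨1, a, ?_⟩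
      rw [pow_one]
      refine hr v hv a ?_
      rw [← ha]
      field_simp
    | one => exact ⟨0, 0, by simp⟩
    | mul x y _ _ hx hy =>
      obtain ⟨q, p, h⟩ := hx
      obtain ⟨q', p', h'⟩ := hy
      refine ⟨q + q', p + p', ?_⟩
      rw [map_mul, h, h', pow_add, pow_add, mul_mul_mul_comm]
    | inv x _ hx =>
      obtain ⟨q, p, h⟩ := hx
      refine ⟨q, p, ?_⟩
      rw [map_inv, h, inv_eq_iff_mul_eq_one, mul_mul_mul_comm, ← mul_pow, ← mul_pow, hρ, hδ,
        one_pow, one_pow, one_mul]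
  obtain ⟨q, p, h⟩ := key
  refine ⟨p, ?_⟩
  rw [h]
  rcases Nat.even_or_odd' q with ⟨c, rfl | rfl⟩
  · left; rw [pow_mul, sq, hρ, one_pow, one_mul]
  · right; rw [pow_succ, pow_mul, sq, hρ, one_pow, one_mul]

end Reflections

/-! ### Classification of quadratic spaces over a finite field and bases with hyperbolic planes. -/

section Classification

variable {K : Type u} [Field K]

theorem exists_mul_sq_add_mul_sq_eq [Finite K] (h2 : (2 : K) ≠ 0) (a b c : K) (ha : a ≠ 0)
    (hb : b ≠ 0) : ∃ x y : K, a * x ^ 2 + b * y ^ 2 = c := by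
  let _ := Fintype.ofFinite K
  have hchar : ringChar K ≠ 2 := fun h => h2 (by
    have := ringChar.spec K 2
    rw [h] at this
    exact_mod_cast this.mpr dvd_rfl)
  obtain ⟨x, y, h⟩ := FiniteField.exists_root_sum_quadratic (R := K) (f := C a * X ^ 2)
    (g := C b * X ^ 2 - C c) (degree_C_mul_X_pow 2 ha)
    (by
      have h := degree_C_mul_X_pow 2 hb
      rw [degree_sub_C (by rw [h]; exact WithBot.coe_lt_coe.mpr two_pos)]
      exact h)
    (FiniteField.odd_card_of_char_ne_two hchar)
  refine ⟨x, y, ?_⟩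
  simp at h
  linear_combination h

/-- A non-degenerate form in two variables represents every value, in particular `1`. So a vector of
norm `1` splits off as long as the dimension is at least 2. -/
theorem exists_orthonormal_but_one_basis [Finite K] (h2 : (2 : K) ≠ 0) (n : ℕ) :
    ∀ (V : Type v) [AddCommGroup V] [Module K V] [FiniteDimensional K V]
      (Ψ : LinearMap.BilinForm K V), Module.finrank K V = n + 1 → Ψ.IsSymm → Ψ.Nondegenerate →
      ∃ (b : Module.Basis (Fin (n + 1)) K V) (d : K), d ≠ 0 ∧
        LinearMap.BilinForm.toMatrix b Ψ =
          Matrix.diagonal fun i => if i = Fin.last n then d else 1 := by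
  induction n with
  | zero =>
    intro V _ _ _ Ψ hn hs hd
    let b : Module.Basis (Fin 1) K V := Module.finBasisOfFinrankEq K V hn
    refine ⟨b, Ψ (b 0) (b 0), ?_, ?_⟩
    · have := (LinearMap.BilinForm.nondegenerate_iff_det_ne_zero b).mp hd
      simpa using this
    · ext i j
      fin_cases i; fin_cases j; simp
  | succ n ih =>
    intro V _ _ _ Ψ hn hs hd
    let _ : Invertible (2 : K) := invertibleOfNonzero h2
    obtain ⟨w, hw1⟩ : ∃ w, Ψ w w = 1 := by
      obtain ⟨b, hb⟩ := LinearMap.BilinForm.exists_orthogonal_basis (B := Ψ) ⟨hs.eq⟩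
      have hbo : ∀ i j, i ≠ j → Ψ (b i) (b j) = 0 := fun i j hij => hb hij
      have hbn : ∀ i, Ψ (b i) (b i) ≠ 0 := fun i h =>
        hb.not_isOrtho_basis_self_of_separatingLeft hd.1 i h
      let i : Fin (Module.finrank K V) := ⟨0, by omega⟩
      let j : Fin (Module.finrank K V) := ⟨1, by omega⟩
      have hij : i ≠ j := by simp [i, j]
      obtain ⟨x, y, hxy⟩ := exists_mul_sq_add_mul_sq_eq h2 _ _ 1 (hbn i) (hbn j)
      refine ⟨x • b i + y • b j, ?_⟩
      simp only [map_add, map_smul, LinearMap.add_apply, LinearMap.smul_apply, smul_eq_mul,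
        hbo i j hij, hbo j i hij.symm]
      linear_combination hxy
    have hw : Ψ w w ≠ 0 := by rw [hw1]; exact one_ne_zero
    have hrefl : Ψ.IsRefl := hs.isRefl
    have hcompl := LinearMap.BilinForm.isCompl_span_singleton_orthogonal hw
    have hw0 : w ≠ 0 := by
      rintro rfl
      simp at hw
    have hfr : Module.finrank K (Ψ.orthogonal (K ∙ w)) = n + 1 := by
      have := Submodule.finrank_add_eq_of_isCompl hcompl
      rw [finrank_span_singleton hw0, hn] at this
      omega
    obtain ⟨b, d, hd0, hb⟩ := ih _ (Ψ.restrict (Ψ.orthogonal (K ∙ w))) hfr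
      ⟨fun x y => hs.eq _ _⟩
      (Ψ.restrict_nondegenerate_orthogonal_spanSingleton hd hrefl hw)
    have hmem : ∀ x ∈ Ψ.orthogonal (K ∙ w), Ψ w x = 0 := fun x hx =>
      hx w (Submodule.mem_span_singleton_self w)
    let b' := Module.Basis.mkFinCons w b (by
      intro c x hx hc
      have := congrArg (Ψ w) hc
      rw [map_add, map_smul, hmem x hx, map_zero, add_zero, smul_eq_mul, hw1, mul_one] at this
      exact this) (by
      intro z
      refine ⟨-Ψ w z, ?_⟩
      intro y hy
      obtain ⟨c, rfl⟩ := Submodule.mem_span_singleton.mp hy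
      change Ψ (c • w) (z + -Ψ w z • w) = 0
      simp [hw1])
    have hb' : (b' : Fin (n + 1 + 1) → V) = Fin.cons w ((↑) ∘ b) := Module.Basis.coe_mkFinCons ..
    refine ⟨b', d, hd0, ?_⟩
    ext i j
    rw [LinearMap.BilinForm.toMatrix_apply, hb']
    refine Fin.cases ?_ (fun i => ?_) i <;> refine Fin.cases ?_ (fun j => ?_) j
    · simp [hw1, Fin.ext_iff]
    · rw [Fin.cons_zero, Fin.cons_succ, Matrix.diagonal_apply_ne _ (Fin.succ_ne_zero j).symm]
      exact hmem _ (b j).2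
    · rw [Fin.cons_zero, Fin.cons_succ, Matrix.diagonal_apply_ne _ (Fin.succ_ne_zero i), hs.eq]
      exact hmem _ (b i).2
    · have := congrFun (congrFun hb i) j
      rw [LinearMap.BilinForm.toMatrix_apply] at this
      rw [Fin.cons_succ, Fin.cons_succ]
      refine Eq.trans this ?_
      simp [Matrix.diagonal_apply, Fin.ext_iff]

/-- Over a finite field of odd characteristic, a non-degenerate symmetric form is represented by
every symmetric matrix of the right size and determinant. -/
theorem exists_basis_toMatrix_eq [Finite K] (h2 : (2 : K) ≠ 0) (V : Type v) [AddCommGroup V]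
    [Module K V] [FiniteDimensional K V] (Ψ : LinearMap.BilinForm K V) (hs : Ψ.IsSymm)
    (hd : Ψ.Nondegenerate) {ι : Type} [Fintype ι] [DecidableEq ι] (G : Matrix ι ι K)
    (hG : G.IsSymm) (hG0 : G.det ≠ 0) {n : ℕ} (hn : Module.finrank K V = n + 1)
    (hι : Fintype.card ι = n + 1) (b₀ : Module.Basis (Fin (n + 1)) K V)
    (hdet : SquareClassEq (LinearMap.BilinForm.toMatrix b₀ Ψ).det G.det) :
    ∃ b : Module.Basis ι K V, LinearMap.BilinForm.toMatrix b Ψ = G := by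
  obtain ⟨b, d, hd0, hb⟩ := exists_orthonormal_but_one_basis h2 n V Ψ hn hs hd
  obtain ⟨c, d', hd0', hc⟩ := exists_orthonormal_but_one_basis h2 n (ι → K) (Matrix.toBilin' G)
    (by rw [Module.finrank_fintype_fun_eq_card, hι]) (Matrix.isSymm_toBilin'_iff_isSymm.mpr hG)
    (by rw [LinearMap.BilinForm.nondegenerate_toBilin'_iff_det_ne_zero]; exact hG0)
  have hprod : ∀ a : K, (Matrix.diagonal fun i => if i = Fin.last n then a else 1).det = a := by
    intro a
    rw [Matrix.det_diagonal, Finset.prod_ite_eq' Finset.univ (Fin.last n) (fun _ => a),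
      if_pos (Finset.mem_univ _)]
  obtain ⟨u, hu0, hu⟩ : SquareClassEq d d' := by
    obtain ⟨u₁, hu₁, h₁⟩ := gram_det_squareClassEq b₀ b Ψ
    obtain ⟨u₂, hu₂, h₂⟩ := hdet
    let e := (Fintype.equivFinOfCardEq hι)
    obtain ⟨u₃, hu₃, h₃⟩ := gram_det_squareClassEq c ((Pi.basisFun K ι).reindex e)
      (Matrix.toBilin' G)
    have h₄ : (LinearMap.BilinForm.toMatrix ((Pi.basisFun K ι).reindex e) (Matrix.toBilin' G)).det =
        G.det := by
      rw [← Matrix.det_reindex_self e G]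
      congr 1
      ext i j
      rw [LinearMap.BilinForm.toMatrix_apply]
      simp [Matrix.toBilin'_single]
    rw [h₄, hc, hprod] at h₃
    rw [hb, hprod] at h₁
    exact ⟨u₁ * u₂ * u₃, by positivity, by rw [h₁, h₂, h₃]; ring⟩
  -- Both forms are `diag(1, …, 1, ·)` with last entries related by `d = u² d'`; scaling the last
  -- vector of `b` by `u⁻¹` makes them equal.
  let w : Fin (n + 1) → Kˣ := fun i => if i = Fin.last n then (Units.mk0 u hu0)⁻¹ else 1
  let e : (ι → K) ≃ₗ[K] V := c.equiv (b.unitsSMul w) (Equiv.refl _)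
  have he : ∀ x y, Ψ (e x) (e y) = Matrix.toBilin' G x y := by
    have : Ψ.comp (e : (ι → K) →ₗ[K] V) (e : (ι → K) →ₗ[K] V) = Matrix.toBilin' G := by
      refine LinearMap.BilinForm.ext_basis c fun i j => ?_
      have h1 := congrFun (congrFun hb i) j
      have h2 := congrFun (congrFun hc i) j
      rw [LinearMap.BilinForm.toMatrix_apply] at h1 h2
      rw [h2, LinearMap.BilinForm.comp_apply]
      simp only [e, LinearEquiv.coe_coe, Module.Basis.equiv_apply, Equiv.refl_apply,
        Module.Basis.unitsSMul_apply, Units.smul_def, map_smul, LinearMap.smul_apply, smul_eq_mul,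
        h1, w]
      by_cases hij : i = j
      · subst hij
        rw [Matrix.diagonal_apply_eq, Matrix.diagonal_apply_eq]
        split_ifs
        · simp [hu]; field_simp
        · simp
      · rw [Matrix.diagonal_apply_ne _ hij, Matrix.diagonal_apply_ne _ hij]; simp
    intro x y
    rw [← this]; rfl
  refine ⟨(Pi.basisFun K ι).map e, ?_⟩
  ext i j
  rw [LinearMap.BilinForm.toMatrix_apply, Module.Basis.map_apply, Module.Basis.map_apply, he]
  simp [Matrix.toBilin'_single]

/-- The Gram matrix of `k` hyperbolic planes and an orthogonal complement in diagonal form. -/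
def wittMatrix (k : ℕ) {r : ℕ} (d : Fin r → K) :
    Matrix ((Fin k ⊕ Fin k) ⊕ Fin r) ((Fin k ⊕ Fin k) ⊕ Fin r) K :=
  Matrix.fromBlocks (Matrix.fromBlocks 0 1 1 0) 0 0 (Matrix.diagonal d)

theorem det_wittMatrix (k : ℕ) {r : ℕ} (d : Fin r → K) :
    (wittMatrix k d).det = (-1) ^ k * ∏ i, d i := by
  have h : (Matrix.fromBlocks 0 1 1 0 : Matrix (Fin k ⊕ Fin k) (Fin k ⊕ Fin k) K) *
      Matrix.fromBlocks 1 0 1 1 = Matrix.fromBlocks 1 1 1 0 := by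
    simp [Matrix.fromBlocks_multiply]
  have h' := congrArg Matrix.det h
  rw [Matrix.det_mul, Matrix.det_fromBlocks_zero₁₂, Matrix.det_fromBlocks_one₁₁] at h'
  simp only [Matrix.det_one, mul_one, zero_sub, Matrix.det_neg, Fintype.card_fin] at h'
  rw [wittMatrix, Matrix.det_fromBlocks_zero₂₁, h', Matrix.det_diagonal]

theorem isSymm_wittMatrix (k : ℕ) {r : ℕ} (d : Fin r → K) : (wittMatrix k d).IsSymm := by
  refine Matrix.IsSymm.fromBlocks (Matrix.IsSymm.fromBlocks ?_ ?_ ?_) (by simp) (by simp) <;>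
    simp

end Classification

/-! ### The diagonal torus and its classes in `O/Ω`. -/

section Torus

variable {K : Type*} [Field K] {V : Type*} [AddCommGroup V] [Module K V]
  {Ψ : LinearMap.BilinForm K V} {k r : ℕ}

/-- The eigenvalues `t i`, `(t i)⁻¹` on the hyperbolic planes and `σ j` on the complement. -/
def wittEigenvalues (t : Fin k → Kˣ) (σ : Fin r → Kˣ) : (Fin k ⊕ Fin k) ⊕ Fin r → Kˣ :=
  Sum.elim (Sum.elim t t⁻¹) σ

/-- The isometry that is diagonal with eigenvalues `wittEigenvalues t σ`. -/
def diagIsometry {d : Fin r → K} (b : Module.Basis ((Fin k ⊕ Fin k) ⊕ Fin r) K V)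
    (hb : LinearMap.BilinForm.toMatrix b Ψ = wittMatrix k d) (t : Fin k → Kˣ) (σ : Fin r → Kˣ)
    (hσ : ∀ i, σ i * σ i = 1) : orthogonalGroup Ψ :=
  ⟨b.equiv (b.unitsSMul (wittEigenvalues t σ)) (Equiv.refl _), by
    set e := b.equiv (b.unitsSMul (wittEigenvalues t σ)) (Equiv.refl _) with he
    have key : Ψ.comp (e : V →ₗ[K] V) (e : V →ₗ[K] V) = Ψ := by
      refine LinearMap.BilinForm.ext_basis b fun i j => ?_
      have h := congrFun (congrFun hb i) j
      rw [LinearMap.BilinForm.toMatrix_apply] at h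
      simp only [LinearMap.BilinForm.comp_apply, he, LinearEquiv.coe_coe,
        Module.Basis.equiv_apply, Equiv.refl_apply, Module.Basis.unitsSMul_apply, Units.smul_def,
        map_smul, LinearMap.smul_apply, smul_eq_mul, h]
      rcases i with (i | i) | i <;> rcases j with (j | j) | j <;>
        simp only [wittMatrix, wittEigenvalues, Matrix.fromBlocks_apply₁₁,
          Matrix.fromBlocks_apply₁₂, Matrix.fromBlocks_apply₂₁, Matrix.fromBlocks_apply₂₂,
          Matrix.zero_apply, mul_zero, Sum.elim_inl, Sum.elim_inr]
      · by_cases hij : i = j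
        · subst hij; simp
        · simp [Matrix.one_apply_ne hij]
      · by_cases hij : i = j
        · subst hij; simp
        · simp [Matrix.one_apply_ne hij]
      · by_cases hij : i = j
        · subst hij
          have := congrArg Units.val (hσ i)
          rw [Units.val_mul, Units.val_one] at this
          rw [← mul_assoc, this, one_mul]
        · simp [Matrix.diagonal_apply_ne _ hij]
    exact fun x y => LinearMap.congr_fun₂ key x y⟩

theorem gram_apply {d : Fin r → K} (b : Module.Basis ((Fin k ⊕ Fin k) ⊕ Fin r) K V)
    (hb : LinearMap.BilinForm.toMatrix b Ψ = wittMatrix k d) (x y : (Fin k ⊕ Fin k) ⊕ Fin r) :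
    Ψ (b x) (b y) = wittMatrix k d x y := by
  rw [← hb, LinearMap.BilinForm.toMatrix_apply]

theorem hyperbolic_sub_smul_self {d : Fin r → K}
    (b : Module.Basis ((Fin k ⊕ Fin k) ⊕ Fin r) K V)
    (hb : LinearMap.BilinForm.toMatrix b Ψ = wittMatrix k d) (i : Fin k) (s : K) :
    Ψ (b (.inl (.inl i)) - s • b (.inl (.inr i))) (b (.inl (.inl i)) - s • b (.inl (.inr i))) =
      -2 * s := by
  simp only [map_sub, map_smul, LinearMap.sub_apply, LinearMap.smul_apply, smul_eq_mul,
    gram_apply b hb, wittMatrix, Matrix.fromBlocks_apply₁₁, Matrix.fromBlocks_apply₁₂,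
    Matrix.fromBlocks_apply₂₁, Matrix.fromBlocks_apply₂₂, Matrix.zero_apply, Matrix.one_apply_eq]
  ring

variable {d : Fin r → K} (b : Module.Basis ((Fin k ⊕ Fin k) ⊕ Fin r) K V)
  (hb : LinearMap.BilinForm.toMatrix b Ψ = wittMatrix k d)

theorem diagIsometry_apply (t : Fin k → Kˣ) (σ : Fin r → Kˣ) (hσ : ∀ i, σ i * σ i = 1)
    (x : (Fin k ⊕ Fin k) ⊕ Fin r) :
    (diagIsometry b hb t σ hσ).1 (b x) = (wittEigenvalues t σ x : K) • b x := by
  simp only [diagIsometry, Module.Basis.equiv_apply, Equiv.refl_apply,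
    Module.Basis.unitsSMul_apply, Units.smul_def]

theorem diagIsometry_mul (t t' : Fin k → Kˣ) (σ σ' : Fin r → Kˣ) (hσ : ∀ i, σ i * σ i = 1)
    (hσ' : ∀ i, σ' i * σ' i = 1) (hσσ : ∀ i, (σ * σ') i * (σ * σ') i = 1) :
    diagIsometry b hb t σ hσ * diagIsometry b hb t' σ' hσ' =
      diagIsometry b hb (t * t') (σ * σ') hσσ := by
  refine Subtype.ext (b.ext' fun x => ?_)
  change (diagIsometry b hb t σ hσ).1 ((diagIsometry b hb t' σ' hσ').1 (b x)) = _
  rw [diagIsometry_apply, map_smul, diagIsometry_apply, diagIsometry_apply, smul_smul]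
  congr 1
  rcases x with (i | i) | i <;> simp [wittEigenvalues, mul_comm]

theorem diagIsometry_one (h : ∀ i : Fin r, (1 : Fin r → Kˣ) i * (1 : Fin r → Kˣ) i = 1) :
    diagIsometry b hb 1 1 h = 1 := by
  refine Subtype.ext (b.ext' fun x => ?_)
  rw [diagIsometry_apply]
  change _ = b x
  rcases x with (i | i) | i <;> simp [wittEigenvalues]

/-- The torus of isometries acting on the hyperbolic planes. -/
def torusHom : (Fin k → Kˣ) →* orthogonalGroup Ψ where
  toFun t := diagIsometry b hb t 1 fun _ => one_mul 1
  map_one' := diagIsometry_one b hb _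
  map_mul' t t' := by
    rw [diagIsometry_mul b hb t t' 1 1 _ _ (fun _ => by simp)]
    simp only [mul_one]

/-- On a hyperbolic plane the reflection in `e - s f` sends `e` to `s f`, and the one in `e - f`
swaps `e` and `f`; their composite is `diag(s, s⁻¹)`. -/
theorem torusHom_mulSingle (h2 : (2 : K) ≠ 0) (hs : Ψ.IsSymm) (i : Fin k) (s : Kˣ)
    (h1 : Ψ (b (.inl (.inl i)) - (1 : K) • b (.inl (.inr i)))
      (b (.inl (.inl i)) - (1 : K) • b (.inl (.inr i))) ≠ 0)
    (hv : Ψ (b (.inl (.inl i)) - (s : K) • b (.inl (.inr i)))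
      (b (.inl (.inl i)) - (s : K) • b (.inl (.inr i))) ≠ 0) :
    torusHom b hb (Pi.mulSingle i s) =
      hyperplaneReflection hs _ h1 * hyperplaneReflection hs _ hv := by
  have hs0 : (s : K) ≠ 0 := s.ne_zero
  refine Subtype.ext (b.ext' fun x => ?_)
  change (diagIsometry b hb _ 1 fun _ => one_mul 1).1 (b x) =
    (hyperplaneReflection hs _ h1).1 ((hyperplaneReflection hs _ hv).1 (b x))
  rw [diagIsometry_apply, hyperplaneReflection_apply, hyperplaneReflection_apply, hyperbolic_sub_smul_self b hb,
    hyperbolic_sub_smul_self b hb]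
  rcases x with (j | j) | j
  · by_cases hij : i = j
    · subst hij
      simp [gram_apply b hb, wittMatrix, wittEigenvalues]
      field_simp
      module
    · simp [gram_apply b hb, wittMatrix, wittEigenvalues, Matrix.one_apply_ne hij,
        Pi.mulSingle_eq_of_ne (Ne.symm hij)]
  · by_cases hij : i = j
    · subst hij
      simp [gram_apply b hb, wittMatrix, wittEigenvalues]
      match_scalars <;> field_simp <;> ring
    · simp [gram_apply b hb, wittMatrix, wittEigenvalues, Matrix.one_apply_ne hij,
        Pi.mulSingle_eq_of_ne (Ne.symm hij)]
  · simp [gram_apply b hb, wittMatrix, wittEigenvalues]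

theorem diagIsometry_mulSingle_neg_one (hs : Ψ.IsSymm) (j : Fin r)
    (hσ : ∀ i, (Pi.mulSingle j (-1) : Fin r → Kˣ) i * (Pi.mulSingle j (-1) : Fin r → Kˣ) i = 1)
    (hv : Ψ (b (.inr j)) (b (.inr j)) ≠ 0) :
    diagIsometry b hb 1 (Pi.mulSingle j (-1)) hσ = hyperplaneReflection hs (b (.inr j)) hv := by
  refine Subtype.ext (b.ext' fun x => ?_)
  rw [diagIsometry_apply, hyperplaneReflection_apply]
  rcases x with (i | i) | i
  · simp [gram_apply b hb, wittMatrix, wittEigenvalues]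
  · simp [gram_apply b hb, wittMatrix, wittEigenvalues]
  · by_cases hij : j = i
    · subst hij
      rw [div_mul_cancel₀ _ hv]
      simp [wittEigenvalues]
      module
    · simp [gram_apply b hb, wittMatrix, wittEigenvalues, Matrix.diagonal_apply_ne _ hij,
        Pi.mulSingle_eq_of_ne (Ne.symm hij)]

/-- Each plane contributes two reflections, of classes `ρ` and `ρ δ^(a i)`, and the two factors `ρ`
cancel. As `δ` is an involution, only the parity of the sum of exponents matters. -/
theorem of_torusHom_pow (h2 : (2 : K) ≠ 0) (hs : Ψ.IsSymm) (g : Kˣ)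
    (ρ δ : Abelianization (orthogonalGroup Ψ)) (hρ : ρ * ρ = 1)
    (hr : ∀ (v : V) (hv : Ψ v v ≠ 0) (a : ℕ), Ψ v v = -2 * (g : K) ^ a →
        Abelianization.of (hyperplaneReflection hs v hv) = ρ * δ ^ a) (a : Fin k → ℕ) :
    Abelianization.of (torusHom b hb fun i => g ^ a i) = δ ^ ∑ i, a i := by
  have key : ∀ i, Abelianization.of (torusHom b hb (Pi.mulSingle i (g ^ a i))) = δ ^ a i := by
    intro i
    have h1 := hyperbolic_sub_smul_self b hb i 1
    have hv := hyperbolic_sub_smul_self b hb i ((g ^ a i : Kˣ) : K)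
    rw [torusHom_mulSingle b hb h2 hs i (g ^ a i)
      (by rw [h1]; simpa using h2)
      (by rw [hv]; exact mul_ne_zero (by simpa using h2) (Units.ne_zero _)), map_mul,
      hr _ _ 0 (by rw [h1, pow_zero]), hr _ _ (a i) (by rw [hv, Units.val_pow_eq_pow_val]),
      pow_zero, mul_one, ← mul_assoc, hρ, one_mul]
  have h := Finset.univ_prod_mulSingle fun i => g ^ a i
  rw [← h, ← MonoidHom.comp_apply, map_prod]
  exact (Finset.prod_congr rfl fun i _ => key i).trans (Finset.prod_pow_eq_pow_sum _ _ _)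

end Torus

theorem separable_and_splits_detOneSub {K : Type*} [Field K] {V : Type*} [AddCommGroup V]
    [Module K V] [FiniteDimensional K V] {ι : Type*} [Fintype ι] [DecidableEq ι]
    (b : Module.Basis ι K V) (M : V →ₗ[K] V) (μ : ι → K) (hμ : Function.Injective μ)
    (hM : ∀ x, M (b x) = μ x • b x) :
    (detOneSub M).Separable ∧ (detOneSub M).Splits := by
  have h1 : LinearMap.toMatrix b b M = Matrix.diagonal μ := by
    ext i j
    rw [LinearMap.toMatrix_apply, hM, map_smul, Module.Basis.repr_self, Finsupp.smul_apply,
      Finsupp.single_apply, Matrix.diagonal_apply]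
    by_cases hij : i = j
    · subst hij; simp
    · simp [hij, Ne.symm hij]
  have h2 : detOneSub M = ∏ i, (1 - C (μ i) * X) := by
    calc detOneSub M = (LinearMap.toMatrix (Module.finBasis K V) (Module.finBasis K V) M).charpolyRev :=
          rfl
      _ = (LinearMap.toMatrix b b M).charpolyRev := by
          rw [← Matrix.reverse_charpoly, ← Matrix.reverse_charpoly, LinearMap.charpoly_toMatrix,
            LinearMap.charpoly_toMatrix]
      _ = (Matrix.diagonal fun i => 1 - C (μ i) * X).det := by
          rw [h1, Matrix.charpolyRev]
          congr 1
          ext1 i j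
          by_cases hij : i = j
          · subst hij; simp [X_mul_C]
          · simp [Matrix.one_apply_ne hij, Matrix.diagonal_apply_ne _ hij]
      _ = _ := Matrix.det_diagonal
  rw [h2]
  refine ⟨separable_prod ?_ fun i => ?_, Splits.prod fun i _ => ?_⟩
  · intro i j hij
    have hne : μ j - μ i ≠ 0 := fun h => hij (hμ (sub_eq_zero.mp h)).symm
    -- Bézout: `μ j (1 - μ i X) - μ i (1 - μ j X) = μ j - μ i`.
    refine ⟨C ((μ j - μ i)⁻¹ * μ j), -C ((μ j - μ i)⁻¹ * μ i), ?_⟩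
    have : C (μ j - μ i)⁻¹ * (C (μ j) - C (μ i)) = (1 : K[X]) := by
      rw [← C_sub, ← C_mul, inv_mul_cancel₀ hne, C_1]
    rw [C_mul, C_mul]
    linear_combination this
  · refine ⟨1, -X, ?_⟩
    simp
  · refine Splits.of_natDegree_le_one ?_
    compute_degree

/-- Choose one root of every square; the bit records whether `c` is the chosen one. It serves to
count coefficients that are known only up to sign. -/
theorem exists_bool_separating_square_roots (K : Type*) [Field K] :
    ∃ s : K → Bool, ∀ c c' : K, c ^ 2 = c' ^ 2 → s c = s c' → c = c' := by
  classical
  have hroot : ∀ y : K, ∃ x : K, (∃ z, z ^ 2 = y) → x ^ 2 = y := fun y => by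
    by_cases h : ∃ z, z ^ 2 = y
    · exact ⟨h.choose, fun _ => h.choose_spec⟩
    · exact ⟨0, fun h' => absurd h' h⟩
  choose root hroot using hroot
  refine ⟨fun c => decide (c = root (c ^ 2)), fun c c' h hs => ?_⟩
  have h1 := hroot (c ^ 2) ⟨c, rfl⟩
  simp only [decide_eq_decide] at hs
  rw [← h] at hs
  by_cases hc : c = root (c ^ 2)
  · rw [hc, ← hs.mp hc]
  · have hc' := mt hs.mpr hc
    rcases sq_eq_sq_iff_eq_or_eq_neg.mp h1.symm with e | e
    · exact absurd e hc
    · rcases sq_eq_sq_iff_eq_or_eq_neg.mp (h.symm.trans h1.symm) with e' | e'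
      · exact absurd e' hc'
      · rw [e, e']

/-! ### Counting by conjugation of regular diagonal isometries. -/

section Count

variable {K : Type*} [Field K] {V : Type*} [AddCommGroup V] [Module K V]
  {Ψ : LinearMap.BilinForm K V} {k r : ℕ} {d : Fin r → K}

/-- The isometries that permute the lines spanned by the vectors of a basis. -/
def monomialIsometries {ι : Type*} (Ψ : LinearMap.BilinForm K V) (b : Module.Basis ι K V) :
    Set (orthogonalGroup Ψ) :=
  {h | ∃ (s : ι → ι) (c : ι → K), ∀ x, h.1 (b x) = c x • b (s x)}

/-- Once the map on indices is fixed, the scalar on one vector of a hyperbolic pair determines the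
scalar on the other, and a scalar on the complement has a determined square. This leaves `k` field
elements and `r` bits. -/
theorem card_monomialIsometries_le [Finite K] (b : Module.Basis ((Fin k ⊕ Fin k) ⊕ Fin r) K V)
    (hb : LinearMap.BilinForm.toMatrix b Ψ = wittMatrix k d) (hd : ∀ i, d i ≠ 0) :
    Nat.card (monomialIsometries Ψ b) ≤
      (k + k + r) ^ (k + k + r) * (Nat.card K ^ k * 2 ^ r) := by
  obtain ⟨bit, hbit⟩ := exists_bool_separating_square_roots K
  have hex : ∀ h : monomialIsometries Ψ b, ∃ (s : _ → _) (c : _ → K),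
    ∀ x, h.1.1 (b x) = c x • b (s x) := fun h => h.2
  choose s c hsc using hex
  let code : monomialIsometries Ψ b →
      (((Fin k ⊕ Fin k) ⊕ Fin r) → ((Fin k ⊕ Fin k) ⊕ Fin r)) × ((Fin k → K) × (Fin r → Bool)) :=
    fun h => (s h, (fun i => c h (.inl (.inl i)), fun j => bit (c h (.inr j))))
  have hcode : Function.Injective code := by
    intro h h' heq
    simp only [code, Prod.mk.injEq] at heq
    obtain ⟨e1, e2, e3⟩ := heq
    have hG : ∀ (h : monomialIsometries Ψ b) x y,
        c h x * (c h y * Ψ (b (s h x)) (b (s h y))) = wittMatrix k d x y := by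
      intro h x y
      rw [← gram_apply b hb, ← h.1.2 (b x) (b y)]
      have e1 := hsc h x
      have e2 := hsc h y
      change h.1.1 (b x) = _ at e1
      rw [e1, e2]
      simp only [map_smul, LinearMap.smul_apply, smul_eq_mul]
      ring
    have hc : ∀ x, c h x = c h' x := by
      rintro ((i | i) | j)
      · exact congrFun e2 i
      · have g1 := hG h (.inl (.inl i)) (.inl (.inr i))
        have g2 := hG h' (.inl (.inl i)) (.inl (.inr i))
        rw [← e1, ← congrFun e2 i] at g2
        simp only [wittMatrix, Matrix.fromBlocks_apply₁₁, Matrix.fromBlocks_apply₁₂,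
          Matrix.one_apply_eq] at g1 g2
        have hne : c h (.inl (.inl i)) * Ψ (b (s h (.inl (.inl i)))) (b (s h (.inl (.inr i)))) ≠ 0 := by
          intro h0
          have : (0 : K) = 1 := by linear_combination g1 - c h (.inl (.inr i)) * h0
          exact zero_ne_one this
        refine mul_right_cancel₀ hne ?_
        linear_combination g1 - g2
      · have g1 := hG h (.inr j) (.inr j)
        have g2 := hG h' (.inr j) (.inr j)
        rw [← e1] at g2
        simp only [wittMatrix, Matrix.fromBlocks_apply₂₂, Matrix.diagonal_apply_eq] at g1 g2
        refine hbit _ _ ?_ (congrFun e3 j)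
        have hne : Ψ (b (s h (.inr j))) (b (s h (.inr j))) ≠ 0 := by
          intro h0
          rw [h0, mul_zero, mul_zero] at g1
          exact hd j g1.symm
        refine mul_right_cancel₀ hne ?_
        linear_combination g1 - g2
    refine Subtype.ext (Subtype.ext (b.ext' fun x => ?_))
    rw [hsc, hsc, hc, e1]
  refine (Nat.card_le_card_of_injective code hcode).trans (le_of_eq ?_)
  simp [Nat.card_prod, Nat.card_fun, Nat.card_eq_fintype_card]

theorem exists_eq_smul_of_diagonal {ι : Type*} [Fintype ι] (b : Module.Basis ι K V)
    (M : V →ₗ[K] V) (μ : ι → K) (hμ : Function.Injective μ) (hM : ∀ x, M (b x) = μ x • b x)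
    (v : V) (hv : v ≠ 0) (l : K) (hl : M v = l • v) : ∃ (y : ι) (c : K), v = c • b y := by
  have hrep : ∀ y, μ y * b.repr v y = l * b.repr v y := by
    intro y
    have h1 : M v = ∑ x, (b.repr v x * μ x) • b x := by
      conv_lhs => rw [← b.sum_repr v, map_sum]
      exact Finset.sum_congr rfl fun x _ => by rw [map_smul, hM, smul_smul]
    have h2 := congrArg (fun w => b.repr w y) (h1.symm.trans hl)
    simp only [Module.Basis.repr_sum_self, map_smul, Finsupp.smul_apply, smul_eq_mul] at h2
    rw [mul_comm]; exact h2
  obtain ⟨y, hy⟩ : ∃ y, b.repr v y ≠ 0 := by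
    by_contra! h
    exact hv (b.repr.map_eq_zero_iff.mp (Finsupp.ext h))
  have hy' : μ y = l := mul_right_cancel₀ hy (hrep y)
  refine ⟨y, b.repr v y, ?_⟩
  conv_lhs => rw [← b.sum_repr v]
  refine Finset.sum_eq_single_of_mem y (Finset.mem_univ _) fun x _ hxy => ?_
  have : b.repr v x = 0 := by
    by_contra h0
    exact hxy (hμ ((mul_right_cancel₀ h0 (hrep x)).trans hy'.symm))
  rw [this, zero_smul]

/-- Conjugation does not change the class in the abelianization, and the basis transported by `h`
diagonalises the conjugate with the same distinct eigenvalues. -/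
theorem mem_Theta_of_conj [FiniteDimensional K V] (α : orthogonalGroup Ψ)
    (b : Module.Basis ((Fin k ⊕ Fin k) ⊕ Fin r) K V)
    (hb : LinearMap.BilinForm.toMatrix b Ψ = wittMatrix k d) (t : Fin k → Kˣ) (σ : Fin r → Kˣ)
    (hσ : ∀ i, σ i * σ i = 1) (hinj : Function.Injective (wittEigenvalues t σ))
    (hα : Abelianization.of (diagIsometry b hb t σ hσ) = Abelianization.of α)
    (h : orthogonalGroup Ψ) : h * diagIsometry b hb t σ hσ * h⁻¹ ∈ Theta Ψ α := by
  refine ⟨⟨α⁻¹ * (h * diagIsometry b hb t σ hσ * h⁻¹), ?_, by group⟩,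
    separable_and_splits_detOneSub (b.map h.1) _ (fun x => (wittEigenvalues t σ x : K))
      (fun x y hxy => hinj (Units.ext hxy)) fun x => ?_⟩
  · refine QuotientGroup.eq.mp (?_ : Abelianization.of α = Abelianization.of _)
    rw [map_mul, map_mul, map_inv, hα, mul_comm, inv_mul_cancel_left]
  · rw [Module.Basis.map_apply]
    change h.1 ((diagIsometry b hb t σ hσ).1 (h.1.symm (h.1 (b x)))) = _
    rw [LinearEquiv.symm_apply_apply, diagIsometry_apply, map_smul]

/-- A family of regular diagonal isometries in the coset of `α` bounds `Θ` from below. -/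
theorem card_mul_card_le_card_Theta_mul [Finite K] [FiniteDimensional K V]
    (α : orthogonalGroup Ψ) (b : Module.Basis ((Fin k ⊕ Fin k) ⊕ Fin r) K V)
    (hb : LinearMap.BilinForm.toMatrix b Ψ = wittMatrix k d) (hd : ∀ i, d i ≠ 0)
    (σ : Fin r → Kˣ) (hσ : ∀ i, σ i * σ i = 1) {B : Type} [Finite B] (t : B → Fin k → Kˣ)
    (ht : Function.Injective t) (hinj : ∀ β, Function.Injective (wittEigenvalues (t β) σ))
    (hα : ∀ β, Abelianization.of (diagIsometry b hb (t β) σ hσ) = Abelianization.of α) :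
    Nat.card (orthogonalGroup Ψ) * Nat.card B ≤
      ((k + k + r) ^ (k + k + r) * (Nat.card K ^ k * 2 ^ r)) * Nat.card (Theta Ψ α) := by
  classical
  have : Finite V := Module.finite_of_finite K
  have : Finite (V ≃ₗ[K] V) := Finite.of_injective (fun e : V ≃ₗ[K] V => (e : V → V))
    DFunLike.coe_injective
  let _ := Fintype.ofFinite (orthogonalGroup Ψ)
  let _ := Fintype.ofFinite B
  let F : orthogonalGroup Ψ × B → Theta Ψ α := fun p =>
    ⟨p.1 * diagIsometry b hb (t p.2) σ hσ * p.1⁻¹,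
      mem_Theta_of_conj α b hb (t p.2) σ hσ (hinj p.2) (hα p.2) p.1⟩
  let _ := Fintype.ofFinite (Theta Ψ α)
  have key := Finset.card_le_mul_card_image_of_maps_to (s := Finset.univ) (t := Finset.univ)
    (f := F) (fun _ _ => Finset.mem_univ _)
    ((k + k + r) ^ (k + k + r) * (Nat.card K ^ k * 2 ^ r)) ?_
  · rwa [Finset.card_univ, Finset.card_univ, Fintype.card_prod, ← Nat.card_eq_fintype_card,
      ← Nat.card_eq_fintype_card, ← Nat.card_eq_fintype_card] at key
  · intro M₀ _
    rcases (Finset.univ.filter fun p => F p = M₀).eq_empty_or_nonempty with he | ⟨p₀, hp₀⟩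
    · rw [he]; exact Nat.zero_le _
    have hF₀ : F p₀ = M₀ := (Finset.mem_filter.mp hp₀).2
    refine le_trans ?_ (card_monomialIsometries_le b hb hd)
    rw [← Fintype.card_coe, ← Nat.card_eq_fintype_card]
    -- Two pairs in one fibre differ by an element intertwining two regular diagonal isometries; it
    -- maps eigenlines to eigenlines and is therefore monomial.
    have hcomm : ∀ p ∈ Finset.univ.filter fun p => F p = M₀,
        diagIsometry b hb (t p₀.2) σ hσ * (p₀.1⁻¹ * p.1) =
          (p₀.1⁻¹ * p.1) * diagIsometry b hb (t p.2) σ hσ := by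
      intro p hp
      have e : p.1 * diagIsometry b hb (t p.2) σ hσ * p.1⁻¹ =
          p₀.1 * diagIsometry b hb (t p₀.2) σ hσ * p₀.1⁻¹ :=
        congrArg Subtype.val ((Finset.mem_filter.mp hp).2.trans hF₀.symm)
      rw [mul_inv_eq_iff_eq_mul] at e
      rw [mul_assoc p₀.1⁻¹, e]
      group
    let f : (Finset.univ.filter fun p => F p = M₀) → monomialIsometries Ψ b := fun p =>
      ⟨p₀.1⁻¹ * p.1.1, by
        have h1 : ∀ x, ∃ (y : _) (c : K), (p₀.1⁻¹ * p.1.1).1 (b x) = c • b y := fun x => by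
          refine exists_eq_smul_of_diagonal b (toEnd (diagIsometry b hb (t p₀.2) σ hσ))
            (fun x => (wittEigenvalues (t p₀.2) σ x : K))
            (fun x y hxy => hinj p₀.2 (Units.ext hxy))
            (fun x => diagIsometry_apply b hb _ _ _ x) _
            (fun h0 => b.ne_zero x ((LinearEquiv.map_eq_zero_iff _).mp h0))
            (wittEigenvalues (t p.1.2) σ x : K) ?_
          have e := congrArg (fun g : orthogonalGroup Ψ => g.1 (b x)) (hcomm p.1 p.2)
          change (diagIsometry b hb (t p₀.2) σ hσ).1 ((p₀.1⁻¹ * p.1.1).1 (b x)) =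
            (p₀.1⁻¹ * p.1.1).1 ((diagIsometry b hb (t p.1.2) σ hσ).1 (b x)) at e
          rw [diagIsometry_apply, map_smul] at e
          exact e
        choose s c hsc using h1
        exact ⟨s, c, hsc⟩⟩
    refine Nat.card_le_card_of_injective f fun p q hpq => ?_
    have e1 : p₀.1⁻¹ * p.1.1 = p₀.1⁻¹ * q.1.1 := congrArg Subtype.val hpq
    -- The monomial isometry recovers `h`, hence the diagonal isometry, hence the index `β`.
    have e2 := hcomm p.1 p.2
    rw [e1, hcomm q.1 q.2] at e2
    have e3 : t p.1.2 = t q.1.2 := by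
      funext i
      have e := congrArg (fun g : orthogonalGroup Ψ => g.1 (b (.inl (.inl i))))
        (mul_left_cancel e2)
      simp only [diagIsometry_apply] at e
      exact (Units.ext (smul_left_injective K (b.ne_zero _) e)).symm
    exact Subtype.ext (Prod.ext (mul_left_cancel e1) (ht e3))

end Count

/-! ### Choice of exponents and the bound for each coset. -/

/-- `B ^ (m + 1)` vectors of distinct positive exponents up to `B (m + 2)` whose sum has a given
parity. -/
theorem exists_exponent_vectors (m B p : ℕ) :
    ∃ a : (Fin (m + 1) → Fin B) → Fin (m + 1) → ℕ, Function.Injective a ∧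
      ∀ β, (∀ i, 1 ≤ a β i ∧ a β i ≤ B * (m + 2)) ∧ Function.Injective (a β) ∧
        (∑ i, a β i) % 2 = p % 2 := by
  -- The tail entries lie in disjoint blocks of length `B` beyond `2B`. The head stays within `1, …,
  -- 2B`: it spends two values on each choice, and the spare bit adjusts the parity of the sum.
  let tail : (Fin (m + 1) → Fin B) → Fin m → ℕ := fun β i =>
    B * ((i : ℕ) + 2) + 1 + (β i.succ : ℕ)
  let head : (Fin (m + 1) → Fin B) → ℕ := fun β =>
    1 + 2 * (β 0 : ℕ) + (p + 1 + ∑ i, tail β i) % 2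
  refine ⟨fun β => Fin.cons (head β) (tail β), ?_, fun β => ⟨?_, ?_, ?_⟩⟩
  · intro β β' h
    have h0 := congrFun h 0
    simp only [Fin.cons_zero, head] at h0
    funext i
    refine Fin.cases ?_ (fun i => ?_) i
    · exact Fin.ext (by omega)
    · have hi := congrFun h i.succ
      simp only [Fin.cons_succ, tail] at hi
      exact Fin.ext (by omega)
  · intro i
    refine Fin.cases ?_ (fun i => ?_) i
    · simp only [Fin.cons_zero, head]
      have := (β 0).2
      have h2 : B * 2 ≤ B * (m + 2) := Nat.mul_le_mul_left B (by omega)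
      omega
    · simp only [Fin.cons_succ, tail]
      have := (β i.succ).2
      have h2 : B * ((i : ℕ) + 3) ≤ B * (m + 2) := Nat.mul_le_mul_left B (by omega)
      rw [mul_add] at h2 ⊢
      omega
  · rw [Fin.cons_injective_iff]
    constructor
    · rintro ⟨i, hi⟩
      simp only [tail, head] at hi
      have := (β 0).2
      have h2 : B * 2 ≤ B * ((i : ℕ) + 2) := Nat.mul_le_mul_left B (by omega)
      omega
    · intro i j hij
      simp only [tail] at hij
      have hi := (β i.succ).2
      have hj := (β j.succ).2
      rcases lt_trichotomy (i : ℕ) j with h | h | h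
      · have h2 : B * ((i : ℕ) + 2 + 1) ≤ B * ((j : ℕ) + 2) := Nat.mul_le_mul_left B (by omega)
        rw [mul_add B _ 1] at h2
        omega
      · exact Fin.ext h
      · have h2 : B * ((j : ℕ) + 2 + 1) ≤ B * ((i : ℕ) + 2) := Nat.mul_le_mul_left B (by omega)
        rw [mul_add B _ 1] at h2
        omega
  · rw [Fin.sum_univ_succ]
    simp only [Fin.cons_zero, Fin.cons_succ, head]
    omega

section Field

variable {K : Type u} [Field K]

/-- With positive exponents below half the order of `g`, a product of two of the powers is never
`1`; this excludes coincidences with inverses and with the square roots of `1` on the complement. -/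
theorem wittEigenvalues_pow_injective {k r : ℕ} (g : Kˣ) (a : Fin k → ℕ)
    (ha : Function.Injective a) (ha1 : ∀ i, 1 ≤ a i) (ha2 : ∀ i, 2 * a i < orderOf g)
    (σ : Fin r → Kˣ) (hσ : ∀ i, σ i * σ i = 1) (hσi : Function.Injective σ) :
    Function.Injective (wittEigenvalues (fun i => g ^ a i) σ) := by
  have hne : ∀ n, 0 < n → n < orderOf g → g ^ n ≠ 1 := fun n h0 h h1 =>
    pow_ne_one_of_lt_orderOf h0.ne' h h1
  have hpow : Function.Injective fun i => g ^ a i := fun i j hij =>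
    ha (pow_injOn_Iio_orderOf (show a i < orderOf g by have := ha2 i; omega)
      (show a j < orderOf g by have := ha2 j; omega) hij)
  have hmul : ∀ i j, g ^ a i ≠ (g ^ a j)⁻¹ := by
    intro i j h
    rw [eq_inv_iff_mul_eq_one, ← pow_add] at h
    have := ha1 i; have := ha2 i; have := ha2 j
    exact hne _ (by omega) (by omega) h
  have hsq : ∀ i j, g ^ a i ≠ σ j := by
    intro i j h
    have h1 := hσ j
    rw [← h, ← pow_add] at h1
    have := ha1 i; have := ha2 i
    exact hne _ (by omega) (by omega) h1
  have hσinv : ∀ j, (σ j)⁻¹ = σ j := fun j => inv_eq_of_mul_eq_one_left (hσ j)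
  rintro ((i | i) | i) ((j | j) | j) h <;>
    simp only [wittEigenvalues, Sum.elim_inl, Sum.elim_inr, Pi.inv_apply] at h
  · rw [hpow h]
  · exact absurd h (hmul i j)
  · exact absurd h (hsq i j)
  · exact absurd h.symm (hmul j i)
  · rw [hpow (inv_injective h)]
  · exact absurd (inv_eq_iff_eq_inv.mp h) (by rw [hσinv]; exact hsq i j)
  · exact absurd h.symm (hsq j i)
  · exact absurd (inv_eq_iff_eq_inv.mp h.symm) (by rw [hσinv]; exact hsq j i)
  · rw [hσi h]

variable {V : Type v} [AddCommGroup V] [Module K V] {Ψ : LinearMap.BilinForm K V}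

theorem det_toMatrix_basis_reindex {ι κ : Type*} [Fintype ι] [DecidableEq ι] [Fintype κ]
    [DecidableEq κ] (b : Module.Basis ι K V) (e : ι ≃ κ) :
    (LinearMap.BilinForm.toMatrix (b.reindex e) Ψ).det =
      (LinearMap.BilinForm.toMatrix b Ψ).det := by
  rw [← Matrix.det_reindex_self e]
  congr 1
  ext i j
  simp [LinearMap.BilinForm.toMatrix_apply]

/-- A nonzero complement absorbs any determinant in its first diagonal entry. Without one, the
determinant must have the class of `(-1)^k`, which is the split condition. -/
theorem exists_basis_toMatrix_eq_wittMatrix [Finite K] [FiniteDimensional K V]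
    (h2 : (2 : K) ≠ 0) (hs : Ψ.IsSymm) (hd : Ψ.Nondegenerate) (k r : ℕ) (hk : 0 < k)
    (hn : Module.finrank K V = k + k + r) (hr : r = 0 → IsSplit Ψ) :
    ∃ (d : Fin r → K) (b : Module.Basis ((Fin k ⊕ Fin k) ⊕ Fin r) K V),
      (∀ i, d i ≠ 0) ∧ LinearMap.BilinForm.toMatrix b Ψ = wittMatrix k d := by
  have hn' : Module.finrank K V = (k + k + r - 1) + 1 := by omega
  have hneg : ((-1 : K) ^ k) * (-1) ^ k = 1 := by rw [← mul_pow]; simp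
  have hneg0 : ((-1 : K) ^ k) ≠ 0 := pow_ne_zero _ (by simp)
  obtain ⟨b, d, hd0, hdet⟩ : ∃ (b : Module.Basis (Fin (Module.finrank K V)) K V) (d : Fin r → K),
      (∀ i, d i ≠ 0) ∧
      SquareClassEq (LinearMap.BilinForm.toMatrix b Ψ).det (wittMatrix k d).det := by
    rcases r with _ | r
    · obtain ⟨b, u, hu, h⟩ := hr rfl
      refine ⟨b, Fin.elim0, fun i => i.elim0, u, hu, ?_⟩
      rw [show Module.finrank K V / 2 = k by omega] at h
      rw [det_wittMatrix, Finset.univ_eq_empty, Finset.prod_empty, mul_one]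
      linear_combination (-1) ^ k * h - (LinearMap.BilinForm.toMatrix b Ψ).det * hneg
    · let b := Module.finBasis K V
      have hb : (LinearMap.BilinForm.toMatrix b Ψ).det ≠ 0 :=
        (LinearMap.BilinForm.nondegenerate_iff_det_ne_zero b).mp hd
      refine ⟨b, Fin.cons ((-1) ^ k * (LinearMap.BilinForm.toMatrix b Ψ).det) fun _ => 1, ?_, 1,
        one_ne_zero, ?_⟩
      · intro i
        refine Fin.cases ?_ (fun i => ?_) i
        · exact mul_ne_zero hneg0 hb
        · exact one_ne_zero
      · rw [det_wittMatrix, Fin.prod_univ_succ]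
        simp only [Fin.cons_zero, Fin.cons_succ, Finset.prod_const_one]
        linear_combination -(LinearMap.BilinForm.toMatrix b Ψ).det * hneg
  obtain ⟨b', hb'⟩ := exists_basis_toMatrix_eq h2 V Ψ hs hd (wittMatrix k d)
    (isSymm_wittMatrix k d)
    (by rw [det_wittMatrix]; exact mul_ne_zero hneg0 (Finset.prod_ne_zero_iff.mpr fun i _ => hd0 i))
    hn' (by simp; omega) (b.reindex (finCongr hn')) (by rwa [det_toMatrix_basis_reindex])
  exact ⟨d, b', hd0, hb'⟩

/-- The lower bound for `Θ`, given an adapted basis of `V` with `k = m + 1` hyperbolic planes. -/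
theorem card_mul_pow_le_card_Theta_mul [Finite K] [FiniteDimensional K V] (h2 : (2 : K) ≠ 0)
    (hs : Ψ.IsSymm) (g : Kˣ) (ρ δ : Abelianization (orthogonalGroup Ψ)) (hρ : ρ * ρ = 1)
    (hδ : δ * δ = 1)
    (hr : ∀ (v : V) (hv : Ψ v v ≠ 0) (a : ℕ), Ψ v v = -2 * (g : K) ^ a →
        Abelianization.of (hyperplaneReflection hs v hv) = ρ * δ ^ a)
    {m r : ℕ} {d : Fin r → K} (b : Module.Basis ((Fin (m + 1) ⊕ Fin (m + 1)) ⊕ Fin r) K V)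
    (hb : LinearMap.BilinForm.toMatrix b Ψ = wittMatrix (m + 1) d) (hd : ∀ i, d i ≠ 0)
    (σ : Fin r → Kˣ) (hσ : ∀ i, σ i * σ i = 1) (hσi : Function.Injective σ)
    (α : orthogonalGroup Ψ) (p : ℕ)
    (hα : Abelianization.of α = δ ^ p * Abelianization.of (diagIsometry b hb 1 σ hσ))
    (B : ℕ) (hB : 2 * (B * (m + 2)) < orderOf g) :
    Nat.card (orthogonalGroup Ψ) * B ^ (m + 1) ≤
      ((m + 1 + (m + 1) + r) ^ (m + 1 + (m + 1) + r) * (Nat.card K ^ (m + 1) * 2 ^ r)) *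
        Nat.card (Theta Ψ α) := by
  obtain ⟨a, ha, hβ⟩ := exists_exponent_vectors m B p
  have hlt : ∀ β i, 2 * a β i < orderOf g := fun β i => by
    have := ((hβ β).1 i).2
    omega
  have hcard : Nat.card (Fin (m + 1) → Fin B) = B ^ (m + 1) := by simp
  rw [← hcard]
  refine card_mul_card_le_card_Theta_mul α b hb hd σ hσ (fun β i => g ^ a β i) ?_ ?_ ?_
  · intro β β' h
    refine ha (funext fun i => ?_)
    exact pow_injOn_Iio_orderOf (show a β i < orderOf g by have := hlt β i; omega)
      (show a β' i < orderOf g by have := hlt β' i; omega) (congrFun h i)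
  · exact fun β => wittEigenvalues_pow_injective g (a β) (hβ β).2.1 (fun i => ((hβ β).1 i).1)
      (hlt β) σ hσ hσi
  · intro β
    have e : diagIsometry b hb (fun i => g ^ a β i) σ hσ =
        torusHom b hb (fun i => g ^ a β i) * diagIsometry b hb 1 σ hσ := by
      have := diagIsometry_mul b hb (fun i => g ^ a β i) 1 1 σ (fun _ => one_mul 1) hσ
        (by simpa using hσ)
      simp only [mul_one, one_mul] at this
      exact this.symm
    have hpar : ∀ n, δ ^ n = δ ^ (n % 2) := fun n => by
      conv_lhs => rw [← Nat.div_add_mod n 2, pow_add, pow_mul, sq, hδ, one_pow, one_mul]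
    rw [e, map_mul, of_torusHom_pow b hb h2 hs g ρ δ hρ hr, hα, hpar, (hβ β).2.2, ← hpar]

theorem exists_card_mul_pow_le_card_Theta_mul [Finite K] [FiniteDimensional K V]
    (h2 : (2 : K) ≠ 0) (hs : Ψ.IsSymm) (hd : Ψ.Nondegenerate) (N : ℕ) (hN : 4 ≤ N)
    (hn : Module.finrank K V = N) (hsplit : Even N → IsSplit Ψ) (α : orthogonalGroup Ψ) :
    ∃ m r : ℕ, m + 1 + (m + 1) + r = N ∧ r ≤ 2 ∧ ∀ B, 2 * (B * (m + 2)) < Nat.card K - 1 →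
      Nat.card (orthogonalGroup Ψ) * B ^ (m + 1) ≤
        (N ^ N * (Nat.card K ^ (m + 1) * 2 ^ r)) * Nat.card (Theta Ψ α) := by
  obtain ⟨g, hg⟩ := IsCyclic.exists_generator (α := Kˣ)
  have hord : orderOf g = Nat.card K - 1 := by
    rw [orderOf_eq_card_of_forall_mem_zpowers hg, Nat.card_units]
  have hbasis : ∀ m r, m + 1 + (m + 1) + r = N →
      ∃ (d : Fin r → K) (b : Module.Basis ((Fin (m + 1) ⊕ Fin (m + 1)) ⊕ Fin r) K V),
        (∀ i, d i ≠ 0) ∧ LinearMap.BilinForm.toMatrix b Ψ = wittMatrix (m + 1) d :=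
    fun m r h => exists_basis_toMatrix_eq_wittMatrix h2 hs hd (m + 1) r (by omega) (by omega)
      fun h0 => hsplit ⟨m + 1, by omega⟩
  have hNe : (N / 2 - 1) + 1 + ((N / 2 - 1) + 1) + N % 2 = N := by omega
  obtain ⟨d, b, hd0, hb⟩ := hbasis _ _ hNe
  obtain ⟨ρ, δ, hρ, hδ, hr⟩ := exists_reflection_classes h2 hs (b (.inl (.inl 0)))
    (b (.inl (.inr 0))) (by simp [gram_apply b hb, wittMatrix])
    (by simp [gram_apply b hb, wittMatrix]) (by simp [gram_apply b hb, wittMatrix]) g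
  -- For class `δ^p` as many planes as possible are used and the complement, of dimension at most
  -- one, is fixed. For class `ρ δ^p` an anisotropic vector is needed to carry a reflection, so for
  -- even `N` one plane is traded for a complement of dimension 2 with eigenvalues `-1` and `1`.
  obtain ⟨p, hp | hp⟩ := exists_of_eq_reflection_class h2 hs hd g hg ρ δ hρ hδ hr α
  · refine ⟨_, _, hNe, by omega, fun B hB => ?_⟩
    have := card_mul_pow_le_card_Theta_mul h2 hs g ρ δ hρ hδ hr b hb hd0 1
      (fun _ => one_mul 1) (fun i j _ => Fin.ext (by omega)) α p
      (by rw [diagIsometry_one, map_one, mul_one, hp]) B (by rwa [hord])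
    rwa [hNe] at this
  · obtain ⟨m, s, hms, hs1⟩ : ∃ m s, m + 1 + (m + 1) + (s + 1) = N ∧ s ≤ 1 := by
      rcases Nat.even_or_odd' N with ⟨c, rfl | rfl⟩
      · exact ⟨c - 2, 1, by omega, le_rfl⟩
      · exact ⟨c - 1, 0, by omega, by omega⟩
    obtain ⟨d, b, hd0, hb⟩ := hbasis _ _ hms
    refine ⟨m, s + 1, hms, by omega, fun B hB => ?_⟩
    have hσ : ∀ i, (Pi.mulSingle 0 (-1) : Fin (s + 1) → Kˣ) i *
        (Pi.mulSingle 0 (-1) : Fin (s + 1) → Kˣ) i = 1 := by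
      intro i
      by_cases hi : i = 0
      · subst hi; simp
      · simp [Pi.mulSingle_eq_of_ne hi]
    have hneg : (-1 : Kˣ) ≠ 1 := by
      intro h
      have h' := congrArg Units.val h
      rw [Units.val_neg, Units.val_one] at h'
      exact h2 (by linear_combination -h')
    have hσi : Function.Injective (Pi.mulSingle 0 (-1) : Fin (s + 1) → Kˣ) := by
      intro i j hij
      by_cases hi : i = 0 <;> by_cases hj : j = 0
      · rw [hi, hj]
      · rw [hi, Pi.mulSingle_eq_same, Pi.mulSingle_eq_of_ne hj] at hij
        exact absurd hij hneg
      · rw [hj, Pi.mulSingle_eq_same, Pi.mulSingle_eq_of_ne hi] at hij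
        exact absurd hij.symm hneg
      · have : (i : ℕ) ≠ 0 := fun h => hi (Fin.ext h)
        have : (j : ℕ) ≠ 0 := fun h => hj (Fin.ext h)
        exact Fin.ext (by omega)
    have hv : Ψ (b (.inr 0)) (b (.inr 0)) = d 0 := by simp [gram_apply b hb, wittMatrix]
    obtain ⟨a, ha⟩ := exists_pow_eq g hg (d 0 / -2) (div_ne_zero (hd0 0) (by simpa using h2))
    have hcls := hr (b (.inr 0)) (by rw [hv]; exact hd0 0) a (by
      rw [hv, ← ha]; field_simp)
    -- The reflection has class `ρ δ^a`; the exponent `p + a` compensates for it, because `δ^(2a) =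
    -- 1`.
    have := card_mul_pow_le_card_Theta_mul h2 hs g ρ δ hρ hδ hr b hb hd0 _ hσ hσi α (p + a)
      (by
        rw [diagIsometry_mulSingle_neg_one b hb hs 0 hσ (by rw [hv]; exact hd0 0), hcls, hp,
          pow_add, mul_mul_mul_comm, ← mul_pow, hδ, one_pow, mul_one, mul_comm]) B (by rwa [hord])
    rwa [hms] at this

end Field

end OrthogonalCount

end

/-! ### The uniform constant. -/

theorem mainTheorem11 (N : ℕ) (hN : 4 ≤ N) :
    (∀ (ℓ : ℕ) [Fact ℓ.Prime], 3 ≤ ℓ →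
      ∀ f : (ZMod ℓ)[X], f.Monic → f.natDegree = N →
        OrthogonalCount.SatisfiesFunctionalEquation N f →
        (∃ Ψ : LinearMap.BilinForm (ZMod ℓ) (Fin N → ZMod ℓ),
          Ψ.IsSymm ∧ Ψ.Nondegenerate ∧
            ∃ γ : OrthogonalCount.orthogonalGroup Ψ,
              (OrthogonalCount.toEnd γ).charpoly = f) ∧
        (Even N → f.eval 1 ≠ 0 → f.eval (-1) ≠ 0 →
          ∀ (V : Type*) [AddCommGroup V] [Module (ZMod ℓ) V] [FiniteDimensional (ZMod ℓ) V]
            (Ψ : LinearMap.BilinForm (ZMod ℓ) V),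
            Module.finrank (ZMod ℓ) V = N → Ψ.IsSymm → Ψ.Nondegenerate →
            ∀ γ : OrthogonalCount.orthogonalGroup Ψ,
              (OrthogonalCount.toEnd γ).charpoly = f →
              OrthogonalCount.HasDet Ψ (f.eval (-1) * f.eval 1))) ∧
    (∃ c : ℝ, 0 < c ∧
      ∀ (ℓ : ℕ) [Fact ℓ.Prime], N + 4 ≤ ℓ →
        ∀ (V : Type*) [AddCommGroup V] [Module (ZMod ℓ) V] [FiniteDimensional (ZMod ℓ) V]
          (Ψ : LinearMap.BilinForm (ZMod ℓ) V),
          Module.finrank (ZMod ℓ) V = N → Ψ.IsSymm → Ψ.Nondegenerate →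
          (Even N → OrthogonalCount.IsSplit Ψ) →
          ∀ α : OrthogonalCount.orthogonalGroup Ψ,
            c ≤ (Nat.card (OrthogonalCount.Theta Ψ α) : ℝ) /
              (Nat.card (OrthogonalCount.derivedOrthogonalGroup Ψ) : ℝ)) := by
  have two_ne : ∀ (ℓ : ℕ) [Fact ℓ.Prime], 3 ≤ ℓ → (2 : ZMod ℓ) ≠ 0 := by
    intro ℓ _ hℓ h
    have : ((2 : ℕ) : ZMod ℓ) = 0 := by exact_mod_cast h
    have := Nat.le_of_dvd (by norm_num) ((ZMod.natCast_eq_zero_iff 2 ℓ).mp this)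
    omega
  refine ⟨fun ℓ _ hℓ f hf hfN hfe => ⟨OrthogonalCount.exists_isometry_charpoly_eq (two_ne ℓ hℓ)
    N f hf hfN hfe, fun hev h1 hm1 V _ _ _ Ψ hn hs hd γ hγ =>
      OrthogonalCount.hasDet_of_isometry_charpoly (two_ne ℓ hℓ) Ψ (by rwa [hn]) hs hd γ hγ h1 hm1⟩,
    ?_⟩
  have hCpos : 0 < N ^ N * ((10 * (N + 1)) ^ N * 4) := by positivity
  refine ⟨1 / ((N ^ N * ((10 * (N + 1)) ^ N * 4) : ℕ) : ℝ),
    one_div_pos.mpr (by exact_mod_cast hCpos), fun ℓ hp hℓ V _ _ _ Ψ hn hs hd hsplit α => ?_⟩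
  obtain ⟨m, r, hmr, hr, hbound⟩ := OrthogonalCount.exists_card_mul_pow_le_card_Theta_mul
    (two_ne ℓ (by omega)) hs hd N hN hn hsplit α
  have hodd : ℓ % 2 = 1 := Nat.odd_iff.mp (hp.out.odd_of_ne_two (by omega))
  -- This is the largest `B` with `2 B (m + 2) ≤ ℓ - 3`, just below the order `ℓ - 1` of a generator
  -- up to parity. It is positive because `ℓ` is odd and `ℓ ≥ N + 4 ≥ 2m + 6`.
  set B := (ℓ - 3) / 2 / (m + 2) with hB
  have hBle : B * (m + 2) ≤ (ℓ - 3) / 2 := Nat.div_mul_le_self _ _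
  have hBpos : 0 < B := Nat.div_pos (by omega) (by omega)
  have hBlt : (ℓ - 3) / 2 < B * (m + 2) + (m + 2) := by
    have := Nat.lt_div_mul_add (a := (ℓ - 3) / 2) (b := m + 2) (by omega)
    exact this
  have hmB : m + 2 ≤ B * (m + 2) := Nat.le_mul_of_pos_left _ hBpos
  -- The factor `10` is generous; what matters is that `ℓ / B` is bounded in terms of `N`. The
  -- factor `4` in the constant bounds `2 ^ r`.
  have hℓB : ℓ ≤ 10 * (m + 2) * B := by
    have : 10 * (m + 2) * B = 10 * (B * (m + 2)) := by ring
    omega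
  have h1 := hbound B (by rw [Nat.card_zmod]; omega)
  rw [Nat.card_zmod] at h1
  have hfin : Finite (OrthogonalCount.orthogonalGroup Ψ) := by
    have : Finite V := Module.finite_of_finite (ZMod ℓ)
    have : Finite (V ≃ₗ[ZMod ℓ] V) := Finite.of_injective
      (fun e : V ≃ₗ[ZMod ℓ] V => (e : V → V)) DFunLike.coe_injective
    infer_instance
  have h2 : Nat.card (OrthogonalCount.derivedOrthogonalGroup Ψ) ≤
      Nat.card (OrthogonalCount.orthogonalGroup Ψ) := Subgroup.card_le_card_group _
  have h3 : ℓ ^ (m + 1) * 2 ^ r ≤ ((10 * (N + 1)) ^ N * 4) * B ^ (m + 1) := by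
    have e1 : ℓ ^ (m + 1) ≤ (10 * (N + 1)) ^ N * B ^ (m + 1) :=
      calc ℓ ^ (m + 1) ≤ (10 * (m + 2) * B) ^ (m + 1) := Nat.pow_le_pow_left hℓB _
        _ = (10 * (m + 2)) ^ (m + 1) * B ^ (m + 1) := mul_pow _ _ _
        _ ≤ (10 * (N + 1)) ^ N * B ^ (m + 1) := Nat.mul_le_mul_right _
          ((Nat.pow_le_pow_left (by omega) _).trans (Nat.pow_le_pow_right (by omega) (by omega)))
    have e2 : 2 ^ r ≤ 4 := (Nat.pow_le_pow_right (by norm_num) hr).trans (by norm_num)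
    calc ℓ ^ (m + 1) * 2 ^ r ≤ ((10 * (N + 1)) ^ N * B ^ (m + 1)) * 4 := Nat.mul_le_mul e1 e2
      _ = _ := by ring
  have h4 : Nat.card (OrthogonalCount.derivedOrthogonalGroup Ψ) ≤
      (N ^ N * ((10 * (N + 1)) ^ N * 4)) * Nat.card (OrthogonalCount.Theta Ψ α) := by
    refine Nat.le_of_mul_le_mul_right ?_ (pow_pos hBpos (m + 1))
    calc Nat.card (OrthogonalCount.derivedOrthogonalGroup Ψ) * B ^ (m + 1)
        ≤ Nat.card (OrthogonalCount.orthogonalGroup Ψ) * B ^ (m + 1) := Nat.mul_le_mul_right _ h2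
      _ ≤ N ^ N * (ℓ ^ (m + 1) * 2 ^ r) * Nat.card (OrthogonalCount.Theta Ψ α) := h1
      _ ≤ N ^ N * (((10 * (N + 1)) ^ N * 4) * B ^ (m + 1)) *
          Nat.card (OrthogonalCount.Theta Ψ α) :=
        Nat.mul_le_mul_right _ (Nat.mul_le_mul_left _ h3)
      _ = _ := by ring
  rw [div_le_div_iff₀ (by exact_mod_cast hCpos) (by exact_mod_cast Nat.card_pos), one_mul, mul_comm]
  exact_mod_cast h4
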